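/- Consider $N$ bosonic modes on $L^2(\mathbb R^N)$ with quadratures $\hat\xi=(\hat q_1,\dots,\hat q_N,\hat p_1,\dots,\hat p_N)$, $[\hat\xi^a,\hat\xi^b]=\mathrm i\,\Omega^{ab}$, $\Omega=\begin{pmatrix}0&1\\-1&0\end{pmatrix}$ and $\omega=\Omega^{-1}$. For a matrix $b$ write $z\,b\,w=z^ab_{ab}w^b$, and $\omega(z,w)=z\,\omega\,w$. For $z\in\mathbb R^{2N}$ let $\widehat z=\mathrm i\,z^a\omega_{ab}\hat\xi^b$ and $\mathcal D(z)=e^{\widehat z}$. Let $J$ be a real $2N\times 2N$ matrix with $J^2=-1$, $J\Omega J^{t}=\Omega$ and $G:=-J\Omega$ positive definite; put $g=G^{-1}$, and let $M^\intercal=GM^{t}g$ be the transpose with respect to $g$. Let $|J\rangle$ be a normalized vector with $\frac12(\delta^a{}_b+\mathrm i J^a{}_b)\hat\xi^b|J\rangle=0$ for all $a$. For an operator $A$ with $\langle J|A|J\rangle\ne0$ let $\Phi_J[A]=\langle J|A|J\rangle/|\langle J|A|J\rangle|$. Let $M\in\mathrm{Sp}(2N,\mathbb R)$, i.e. $M\Omega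 M^t=\Omega$, and let $$\Delta_M=-MJM^{-1}J,\qquad Y_M=\frac{1-\Delta_M}{1+\Delta_M}.$$ Let $T=\sqrt{\Delta_M}$ be the positive square root with respect to $g$ (the positive part of the Cartan decomposition of $M$), and let $\mathcal S(T,1)$ be the unitary operator $S$ characterized by $S^\dagger\hat\xi^aS=T^a{}_b\hat\xi^b$ for all $a$ and $\Phi_J[S]=1$. Then $\Delta_M=MM^\intercal$, the matrices $1+\Delta_M$ and $C=\frac12(M^{-1}-JM^{-1}J)$ are invertible, and $$Y_M=\frac{2}{1+\Delta_M}-1=C^{-1}D\quad\text{with } D=\tfrac12(M^{-1}+JM^{-1}J).$$ Moreover $\det(1-Y_M^2)>0$, and for every $z\in\mathbb R^{2N}$ $$\langle J|\mathcal D(z)\mathcal S(T,1)|J\rangle=\det(1-Y_M^2)^{1/8}\,e^{-\frac14 z\,g(1+Y_M)\,z}\,e^{\frac{\mathrm i}{4}z\,\omega Y_M\,z}.$$ Consequently $\Phi_J[\mathcal D(z)\mathcal S(T,1)]=e^{\mathrm i\gamma(M,z)}$, where $$\gamma(M,z)=\tfrac{\mathrm i}{4}[\widehat{Y_Mz},\widehat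 z]=\tfrac14 z\,\omega Y_M\,z=\tfrac14\,\omega(z,Y_Mz)$$ (the commutator is this multiple of the identity on Schwartz functions), and $$|\langle J|\mathcal D(z)\mathcal S(T,1)|J\rangle|=|\langle J|\mathcal S(T,1)|J\rangle|\;e^{-\frac12 z\,g(1+MM^\intercal)^{-1}z},\qquad \langle J|\mathcal S(T,1)|J\rangle=\det(1-Y_M^2)^{1/8}.$$ -/

import Mathlib

open MeasureTheory Matrix Complex
open scoped SchwartzMap LineDeriv ComplexConjugate

noncomputable section

/-! ### Phase space of `N` bosonic modes -/

/-- Labels of the quadratures: `inl j` stands for `q_j` and `inr j` for `p_j`. -/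
abbrev Quad (N : ℕ) : Type := Fin N ⊕ Fin N

/-- Vectors `z = (z_q, z_p)` of the classical phase space `ℝ^{2N}`. -/
abbrev PhaseVec (N : ℕ) : Type := Quad N → ℝ

/-- Real `2N × 2N` matrices. -/
abbrev PhaseMat (N : ℕ) : Type := Matrix (Quad N) (Quad N) ℝ

/-- The symplectic form `Ω^{ab}`, with `[ξ^a, ξ^b] = i Ω^{ab}`. -/
def symOmega (N : ℕ) : PhaseMat N := Matrix.fromBlocks 0 1 (-1) 0

/-- The inverse `ω_{ab}` of `Ω^{ab}`. -/
def symOmegaInv (N : ℕ) : PhaseMat N := Matrix.fromBlocks 0 (-1) 1 0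

theorem symOmega_mul_inv (N : ℕ) : symOmega N * symOmegaInv N = 1 := by
  simp [symOmega, symOmegaInv, Matrix.fromBlocks_multiply]

/-- The bilinear form `z b w = z^a b_{ab} w^b` of a matrix `b`. -/
def bil {N : ℕ} (b : PhaseMat N) (z w : PhaseVec N) : ℝ := z ⬝ᵥ (b *ᵥ w)

/-- The complex structures which define Gaussian states: `J² = -1`, `J Ω Jᵀ = Ω`, and `-JΩ`
positive definite. -/
structure IsGaussianStructure {N : ℕ} (J : PhaseMat N) : Prop where
  sq : J * J = -1
  symplectic : J * symOmega N * Jᵀ = symOmega N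
  pos : (-(J * symOmega N)).PosDef

/-- The metric `G^{ab}` of the Kähler triple, the solution of `G ω = -J`. -/
def kahlerG {N : ℕ} (J : PhaseMat N) : PhaseMat N := -(J * symOmega N)

/-- The inverse metric `g_{ab}`. -/
def kahlerInv {N : ℕ} (J : PhaseMat N) : PhaseMat N := (kahlerG J)⁻¹

/-- The transpose `M^⊺ = G Mᵗ g` with respect to the metric, i.e. the adjoint of the linear map `M`
for the inner product `g`. For `G = 1` it is the transposed matrix. -/
def metricTranspose {N : ℕ} (J M : PhaseMat N) : PhaseMat N := kahlerG J * Mᵀ * kahlerInv J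

/-- The `J`-linear part `C_M = (M - JMJ)/2`. -/
def linPart {N : ℕ} (J M : PhaseMat N) : PhaseMat N := (1 / 2 : ℝ) • (M - J * M * J)

/-- The `J`-antilinear part `D_M = (M + JMJ)/2`. -/
def antilinPart {N : ℕ} (J M : PhaseMat N) : PhaseMat N := (1 / 2 : ℝ) • (M + J * M * J)

/-- `Z_M = C_M⁻¹ D_M`. -/
def zMat {N : ℕ} (J M : PhaseMat N) : PhaseMat N := (linPart J M)⁻¹ * antilinPart J M

/-- `Δ_M = -M J M⁻¹ J`. -/
def deltaMat {N : ℕ} (J M : PhaseMat N) : PhaseMat N := -(M * J * M⁻¹ * J)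

/-- `Y_M = (1 - Δ_M)/(1 + Δ_M)`. -/
def yMat {N : ℕ} (J M : PhaseMat N) : PhaseMat N := (1 - deltaMat J M) * (1 + deltaMat J M)⁻¹

/-- `T` is the positive square root of `A` with respect to the metric: `T² = A`, and `T` is
self-adjoint and positive definite for the inner product `g`. -/
structure IsPosSqrt {N : ℕ} (J A T : PhaseMat N) : Prop where
  sq : T * T = A
  pos : (kahlerInv J * T).PosDef

/-- The displaced-squeezing phase `γ(M, z) = ω(z, Y_M z) / 4`. -/
def gammaPhase {N : ℕ} (J M : PhaseMat N) (z : PhaseVec N) : ℝ :=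
  (1 / 4) * bil (symOmegaInv N) z (yMat J M *ᵥ z)

/-! ### The Schrödinger representation -/

/-- The configuration space `ℝ^N`. -/
abbrev Config (N : ℕ) : Type := EuclideanSpace ℝ (Fin N)

/-- The Hilbert space `L²(ℝ^N; ℂ)` of `N` bosonic modes. -/
abbrev Hilb (N : ℕ) : Type := Lp ℂ 2 (volume : Measure (Config N))

/-- The canonical operators on Schwartz functions: `q_j` is multiplication by `x_j`, and `p_j` is
`-i ∂/∂x_j`. -/
def xiS {N : ℕ} : Quad N → 𝓢(Config N, ℂ) →L[ℂ] 𝓢(Config N, ℂ)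
  | Sum.inl j => SchwartzMap.smulLeftCLM ℂ (fun x : Config N => ((x j : ℝ) : ℂ))
  | Sum.inr j => (-I) • LineDeriv.lineDerivOpCLM ℂ 𝓢(Config N, ℂ)
      (EuclideanSpace.single j (1 : ℝ) : Config N)

theorem xiS_inl_apply {N : ℕ} (j : Fin N) (f : 𝓢(Config N, ℂ)) (x : Config N) :
    xiS (Sum.inl j) f x = (x j : ℂ) * f x := by
  have h : Function.HasTemperateGrowth (fun x : Config N => ((x j : ℝ) : ℂ)) := by
    have := (Complex.ofRealCLM.comp
      (EuclideanSpace.proj j : Config N →L[ℝ] ℝ)).hasTemperateGrowth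
    exact this
  simp [xiS, SchwartzMap.smulLeftCLM_apply_apply h]

theorem xiS_inr_apply {N : ℕ} (j : Fin N) (f : 𝓢(Config N, ℂ)) (x : Config N) :
    xiS (Sum.inr j) f x = -I * fderiv ℝ f x (EuclideanSpace.single j 1) := by
  simp [xiS, SchwartzMap.lineDerivOp_apply_eq_fderiv]

/-- The linear observable `w_a ξ^a` on Schwartz functions. -/
def obsS {N : ℕ} (w : PhaseVec N) : 𝓢(Config N, ℂ) →L[ℂ] 𝓢(Config N, ℂ) :=
  ∑ a, (w a : ℂ) • xiS a

/-- `ẑ = -z^a λ_{ab} ξ^b = i z^a ω_{ab} ξ^b` on Schwartz functions, where `λ = -i ω`. -/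
def hatS {N : ℕ} (z : PhaseVec N) : 𝓢(Config N, ℂ) →L[ℂ] 𝓢(Config N, ℂ) :=
  I • obsS (z ᵥ* symOmegaInv N)

/-- A Schwartz function as a vector of the Hilbert space. -/
def toHilb {N : ℕ} (f : 𝓢(Config N, ℂ)) : Hilb N := f.toLp 2 volume

/-- The graph of the self-adjoint operator `w_a ξ^a` on `L²`: `φ` lies in the domain, and
`w_a ξ^a φ = η`. The operator is the adjoint of its restriction to Schwartz functions; since this
restriction is essentially self-adjoint, the adjoint is also its closure. -/
def ObsGraph {N : ℕ} (w : PhaseVec N) (φ η : Hilb N) : Prop :=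
  ∀ h : 𝓢(Config N, ℂ), inner ℂ (toHilb (obsS w h)) φ = inner ℂ (toHilb h) η

/-- The quadrature operator `ξ^a`. -/
def XiGraph {N : ℕ} (a : Quad N) (φ η : Hilb N) : Prop := ObsGraph (Pi.single a 1) φ η

/-- `φ` is a state vector `|J⟩`: it is normalized, and `(1/2)(δ^a_b + i J^a_b) ξ^b φ = 0` for all
`a` (in particular, it lies in the domain of every `ξ^b`). -/
def IsGaussianState {N : ℕ} (J : PhaseMat N) (φ : Hilb N) : Prop :=
  ‖φ‖ = 1 ∧ ∃ η : Quad N → Hilb N, (∀ b, XiGraph b φ (η b)) ∧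
    ∀ a, ∑ b, ((1 / 2 : ℂ) * ((1 : PhaseMat N) a b + I * J a b)) • η b = 0

/-- The expectation value `⟨φ|A|φ⟩`. -/
def expVal {N : ℕ} (φ : Hilb N) (A : Hilb N → Hilb N) : ℂ := inner ℂ φ (A φ)

/-- The reference complex phase `⟨φ|A|φ⟩ / |⟨φ|A|φ⟩|`; it is a number of modulus one exactly
if the expectation value does not vanish. -/
def refPhase {N : ℕ} (φ : Hilb N) (A : Hilb N → Hilb N) : ℂ :=
  expVal φ A / (‖expVal φ A‖ : ℂ)

/-- `S` is the squeezing operator `S(M, ψ)`: a unitary operator with `S† ξ^a S = M^a_b ξ^b`, as an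
equality of self-adjoint operators, whose reference complex phase is `ψ*`. -/
structure IsSqueezing {N : ℕ} (φ : Hilb N) (M : PhaseMat N) (ψ : ℂ)
    (S : Hilb N ≃ₗᵢ[ℂ] Hilb N) : Prop where
  covariance : ∀ (a : Quad N) (u v : Hilb N), XiGraph a (S u) (S v) ↔ ObsGraph (M a) u v
  phase : refPhase φ S = conj ψ

/-! ### Displacement operators -/

/-- The position part `z_q` of a phase space vector. -/
def qPart {N : ℕ} (z : PhaseVec N) : Config N := WithLp.toLp 2 (fun j => z (Sum.inl j))

/-- The phase factor `exp(i z_p · x - (i/2) z_q · z_p)`. -/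
def weylFactor {N : ℕ} (z : PhaseVec N) (x : Config N) : ℂ :=
  cexp (I * ((∑ j, z (Sum.inr j) * x j : ℝ) : ℂ)
    - I / 2 * ((∑ j, z (Sum.inl j) * z (Sum.inr j) : ℝ) : ℂ))

theorem norm_weylFactor {N : ℕ} (z : PhaseVec N) (x : Config N) : ‖weylFactor z x‖ = 1 := by
  rw [weylFactor, Complex.norm_exp]
  simp only [Complex.sub_re, Complex.mul_re, Complex.ofReal_re, Complex.ofReal_im, Complex.I_re, Complex.I_im, Complex.div_ofNat_re, Complex.div_ofNat_im]
  simp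

theorem continuous_weylFactor {N : ℕ} (z : PhaseVec N) : Continuous (weylFactor z) := by
  unfold weylFactor
  fun_prop

/-- Translation by `a` on `L²`: `ψ(x) ↦ ψ(x - a)`. -/
def translation {N : ℕ} (a : Config N) : Hilb N →ₗᵢ[ℂ] Hilb N :=
  Lp.compMeasurePreservingₗᵢ ℂ (fun x => x - a) (measurePreserving_sub_right volume a)

theorem memLp_weylFactor_mul {N : ℕ} (z : PhaseVec N) (u : Hilb N) :
    MemLp (fun x => weylFactor z x * u x) 2 (volume : Measure (Config N)) := by
  refine (Lp.memLp u).of_le ((continuous_weylFactor z).aestronglyMeasurable.mul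
    (Lp.aestronglyMeasurable u)) (Filter.Eventually.of_forall fun x => ?_)
  rw [norm_mul, norm_weylFactor, one_mul]

/-- Multiplication by the phase factor of `z` on `L²`. -/
def modulation {N : ℕ} (z : PhaseVec N) : Hilb N →ₗᵢ[ℂ] Hilb N where
  toFun u := (memLp_weylFactor_mul z u).toLp
  map_add' u v := by
    rw [← MemLp.toLp_add]
    refine MemLp.toLp_congr _ _ ?_
    filter_upwards [Lp.coeFn_add u v] with x hx
    simp only [hx, Pi.add_apply, mul_add]
  map_smul' c u := by
    rw [RingHom.id_apply, ← MemLp.toLp_const_smul]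
    refine MemLp.toLp_congr _ _ ?_
    filter_upwards [Lp.coeFn_smul c u] with x hx
    simp [hx]
    ring
  norm_map' u := by
    change ‖(memLp_weylFactor_mul z u).toLp‖ = ‖u‖
    rw [Lp.norm_toLp, Lp.norm_def]
    congr 1
    refine eLpNorm_congr_norm_ae (Filter.Eventually.of_forall fun x => ?_)
    rw [norm_mul, norm_weylFactor, one_mul]

/-- The displacement operator `D(z) = exp(ẑ) = exp(i (z_p · q - z_q · p))` on `L²`,
`(D(z) ψ)(x) = exp(i z_p · x - (i/2) z_q · z_p) ψ(x - z_q)`. -/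
def displacement {N : ℕ} (z : PhaseVec N) : Hilb N →ₗᵢ[ℂ] Hilb N :=
  (modulation z).comp (translation (qPart z))

theorem displacement_ae {N : ℕ} (z : PhaseVec N) (u : Hilb N) :
    displacement z u =ᵐ[volume] fun x => weylFactor z x * u (x - qPart z) := by
  have h1 : displacement z u =ᵐ[volume]
      fun x => weylFactor z x * translation (qPart z) u x :=
    MemLp.coeFn_toLp (memLp_weylFactor_mul z (translation (qPart z) u))
  have h2 : translation (qPart z) u =ᵐ[volume] fun x => u (x - qPart z) :=
    Lp.coeFn_compMeasurePreserving u (measurePreserving_sub_right volume (qPart z))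
  filter_upwards [h1, h2] with x hx1 hx2
  rw [hx1, hx2]


/-! `displacement` is the exponential of `ẑ`: `t ↦ D(t z)` is a one-parameter group of isometries
whose derivative at `0` on every Schwartz function `f` is `ẑ f`. -/

theorem displacement_add {N : ℕ} (z : PhaseVec N) (s t : ℝ) (u : Hilb N) :
    displacement (s • z) (displacement (t • z) u) = displacement ((s + t) • z) u := by
  have hq : ∀ r : ℝ, qPart (r • z) = r • qPart z := fun r => by ext j; simp [qPart]
  refine Lp.ext ?_
  have h3 := (measurePreserving_sub_right volume (qPart (s • z))).quasiMeasurePreserving.ae_eq_comp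
    (displacement_ae (t • z) u)
  filter_upwards [displacement_ae (s • z) (displacement (t • z) u),
    displacement_ae ((s + t) • z) u, h3] with x h1 h2 h3
  simp only [Function.comp_apply] at h3
  rw [h1, h2, h3, ← mul_assoc]
  have e1 : x - qPart (s • z) - qPart (t • z) = x - qPart ((s + t) • z) := by
    simp only [hq]; module
  have e2 : weylFactor (s • z) x * weylFactor (t • z) (x - qPart (s • z)) =
      weylFactor ((s + t) • z) x := by
    simp only [weylFactor, ← Complex.exp_add]
    congr 1
    simp only [Pi.smul_apply, smul_eq_mul, hq, PiLp.sub_apply, PiLp.smul_apply]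
    have a1 : ∀ r : ℝ, ∑ j, r * z (Sum.inr j) * x j = r * ∑ j, z (Sum.inr j) * x j := fun r => by
      rw [Finset.mul_sum]; exact Finset.sum_congr rfl fun j _ => by ring
    have a2 : ∀ r : ℝ, ∑ j, r * z (Sum.inl j) * (r * z (Sum.inr j)) =
        r ^ 2 * ∑ j, z (Sum.inl j) * z (Sum.inr j) := fun r => by
      rw [Finset.mul_sum]; exact Finset.sum_congr rfl fun j _ => by ring
    have a3 : ∑ j, t * z (Sum.inr j) * (x j - s * qPart z j) =
        t * (∑ j, z (Sum.inr j) * x j) - t * s * ∑ j, z (Sum.inl j) * z (Sum.inr j) := by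
      rw [Finset.mul_sum, Finset.mul_sum, ← Finset.sum_sub_distrib]
      exact Finset.sum_congr rfl fun j _ => by simp only [qPart]; ring
    rw [a1, a1, a2, a2, a2, a3]
    push_cast
    ring
  rw [e1, e2]

theorem hatS_apply {N : ℕ} (z : PhaseVec N) (f : 𝓢(Config N, ℂ)) (x : Config N) :
    hatS z f x = I * ((∑ j, z (Sum.inr j) * x j : ℝ) : ℂ) * f x - fderiv ℝ f x (qPart z) := by
  have hl : ∀ j, (z ᵥ* symOmegaInv N) (Sum.inl j) = z (Sum.inr j) := fun j => by
    simp [symOmegaInv, Matrix.vecMul, dotProduct, Matrix.one_apply]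
  have hr : ∀ j, (z ᵥ* symOmegaInv N) (Sum.inr j) = -z (Sum.inl j) := fun j => by
    simp [symOmegaInv, Matrix.vecMul, dotProduct, Matrix.one_apply]
  have hq : qPart z = ∑ j, z (Sum.inl j) • (EuclideanSpace.single j (1 : ℝ) : Config N) := by
    ext k
    simp [qPart, Finset.sum_apply, Pi.single_apply]
  have hs : ∀ (w : PhaseVec N), obsS w f x = ∑ a, (w a : ℂ) * xiS a f x := fun w => by
    simp [obsS]
  have : hatS z f x = I * obsS (z ᵥ* symOmegaInv N) f x := by simp [hatS]
  rw [this, hs, Fintype.sum_sum_type, hq, map_sum]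
  simp only [hl, hr, xiS_inl_apply, xiS_inr_apply, map_smul, Complex.real_smul]
  push_cast
  rw [mul_add, Finset.mul_sum, Finset.mul_sum, Finset.mul_sum, Finset.sum_mul, sub_eq_add_neg,
    ← Finset.sum_neg_distrib]
  congr 1
  · exact Finset.sum_congr rfl fun j _ => by ring
  · refine Finset.sum_congr rfl fun j _ => ?_
    linear_combination (z (Sum.inl j) : ℂ) * fderiv ℝ f x (EuclideanSpace.single j 1) * I_mul_I

theorem hasDerivAt_weyl {N : ℕ} (z : PhaseVec N) (f : 𝓢(Config N, ℂ)) (x : Config N) (t : ℝ) :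
    HasDerivAt (fun t : ℝ => weylFactor (t • z) x * f (x - t • qPart z))
      (weylFactor (t • z) x * hatS z f (x - t • qPart z)) t := by
  have hw : ∀ t : ℝ, weylFactor (t • z) x =
      cexp ((t : ℂ) * (I * ((∑ j, z (Sum.inr j) * x j : ℝ) : ℂ))
        - (t : ℂ) ^ 2 * (I / 2 * ((∑ j, z (Sum.inl j) * z (Sum.inr j) : ℝ) : ℂ))) := fun t => by
    have a1 : ∑ j, t * z (Sum.inr j) * x j = t * ∑ j, z (Sum.inr j) * x j := by
      rw [Finset.mul_sum]; exact Finset.sum_congr rfl fun j _ => by ring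
    have a2 : ∑ j, t * z (Sum.inl j) * (t * z (Sum.inr j)) =
        t ^ 2 * ∑ j, z (Sum.inl j) * z (Sum.inr j) := by
      rw [Finset.mul_sum]; exact Finset.sum_congr rfl fun j _ => by ring
    simp only [weylFactor, Pi.smul_apply, smul_eq_mul]
    rw [a1, a2]
    push_cast
    ring_nf
  have a3 : ∑ j, z (Sum.inr j) * (x - t • qPart z) j =
      (∑ j, z (Sum.inr j) * x j) - t * ∑ j, z (Sum.inl j) * z (Sum.inr j) := by
    rw [Finset.mul_sum, ← Finset.sum_sub_distrib]
    exact Finset.sum_congr rfl fun j _ => by simp [qPart]; ring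
  rw [hatS_apply, a3, hw t]
  simp only [hw]
  have ht : HasDerivAt (fun t : ℝ => (t : ℂ)) 1 t := Complex.ofRealCLM.hasDerivAt
  have d1 := ((ht.mul_const (I * ((∑ j, z (Sum.inr j) * x j : ℝ) : ℂ))).sub
    ((ht.pow 2).mul_const (I / 2 * ((∑ j, z (Sum.inl j) * z (Sum.inr j) : ℝ) : ℂ)))).cexp
  have d2 : HasDerivAt (fun t : ℝ => x - t • qPart z) (-qPart z) t := by
    simpa using ((hasDerivAt_id t).smul_const (qPart z)).const_sub x
  have d3 := (f.differentiableAt (x := x - t • qPart z)).hasFDerivAt.comp_hasDerivAt t d2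
  refine (d1.mul d3).congr_deriv ?_
  simp only [map_neg, Function.comp_apply, Pi.sub_apply, Pi.pow_apply]
  push_cast
  ring

theorem displacement_hasDerivAt {N : ℕ} (z : PhaseVec N) (f : 𝓢(Config N, ℂ)) :
    HasDerivAt (fun t : ℝ => displacement (t • z) (toHilb f)) (toHilb (hatS z f)) 0 := by
  have hq : ∀ r : ℝ, qPart (r • z) = r • qPart z := fun r => by ext j; simp [qPart]
  set k := hatS z (hatS z f)
  set m : ℕ := N + 1
  obtain ⟨C, hC0, hC⟩ : ∃ C : ℝ, 0 ≤ C ∧ ∀ y, (1 + ‖y‖) ^ m * ‖k y‖ ≤ C := by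
    have h : ∃ C : ℝ, ∀ y, (1 + ‖y‖) ^ m * ‖k y‖ ≤ C := by
      refine ⟨2 ^ m * ((Finset.Iic (m, 0)).sup fun p => SchwartzMap.seminorm ℝ p.1 p.2) k,
        fun y => ?_⟩
      simpa using SchwartzMap.one_add_le_sup_seminorm_apply (𝕜 := ℝ) (m := (m, 0)) (k := m)
        (n := 0) le_rfl le_rfl k y
    obtain ⟨C, hC⟩ := h
    exact ⟨C, le_trans (by positivity) (hC 0), hC⟩
  set B : Config N → ℝ := fun x => C * (1 + ‖qPart z‖) ^ m * ((1 + ‖x‖) ^ m)⁻¹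
  have hB0 : ∀ x, 0 ≤ B x := fun x => by positivity
  have hBcont : Continuous B := by
    refine continuous_const.mul (Continuous.inv₀ (by fun_prop) fun x => by positivity)
  have hB : MemLp B 2 (volume : Measure (Config N)) := by
    rw [memLp_two_iff_integrable_sq hBcont.aestronglyMeasurable]
    have hi : Integrable (fun x : Config N => (1 + ‖x‖) ^ (-((2 * m : ℕ) : ℝ))) := by
      refine integrable_one_add_norm ?_
      rw [finrank_euclideanSpace_fin]
      push_cast [m]
      have : (0 : ℝ) ≤ N := Nat.cast_nonneg N
      linarith
    refine (hi.const_mul ((C * (1 + ‖qPart z‖) ^ m) ^ 2)).congr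
      (Filter.Eventually.of_forall fun x => ?_)
    simp only [B]
    rw [Real.rpow_neg (by positivity), Real.rpow_natCast, mul_comm 2 m, pow_mul]
    rw [mul_pow _ (((1 + ‖x‖) ^ m)⁻¹), inv_pow]
  have hk : ∀ (x : Config N) (s : ℝ), |s| ≤ 1 → ‖k (x - s • qPart z)‖ ≤ B x := by
    intro x s hs
    have h1 : 1 + ‖x‖ ≤ (1 + ‖qPart z‖) * (1 + ‖x - s • qPart z‖) := by
      have h2 : ‖x‖ ≤ ‖x - s • qPart z‖ + ‖s • qPart z‖ := by
        simpa using norm_add_le (x - s • qPart z) (s • qPart z)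
      have h3 : ‖s • qPart z‖ ≤ ‖qPart z‖ := by
        rw [norm_smul, Real.norm_eq_abs]
        exact mul_le_of_le_one_left (norm_nonneg _) hs
      nlinarith [norm_nonneg (qPart z), norm_nonneg (x - s • qPart z)]
    have h4 := hC (x - s • qPart z)
    have h5 : (1 + ‖x‖) ^ m ≤ (1 + ‖qPart z‖) ^ m * (1 + ‖x - s • qPart z‖) ^ m := by
      rw [← mul_pow]
      exact pow_le_pow_left₀ (by positivity) h1 m
    have h6 : (0 : ℝ) < (1 + ‖x‖) ^ m := by positivity
    simp only [B]
    rw [← div_eq_mul_inv, le_div_iff₀ h6]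
    calc ‖k (x - s • qPart z)‖ * (1 + ‖x‖) ^ m
        ≤ ‖k (x - s • qPart z)‖ * ((1 + ‖qPart z‖) ^ m * (1 + ‖x - s • qPart z‖) ^ m) := by gcongr
      _ = (1 + ‖qPart z‖) ^ m * ((1 + ‖x - s • qPart z‖) ^ m * ‖k (x - s • qPart z)‖) := by ring
      _ ≤ (1 + ‖qPart z‖) ^ m * C := by gcongr
      _ = C * (1 + ‖qPart z‖) ^ m := by ring
  have h0 : ∀ x, weylFactor ((0 : ℝ) • z) x = 1 := fun x => by simp [weylFactor]
  have h0' : ∀ x, weylFactor (0 : PhaseVec N) x = 1 := fun x => by simp [weylFactor]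
  -- first order Taylor estimate, pointwise
  have hpt : ∀ (x : Config N) (t : ℝ), |t| ≤ 1 →
      ‖weylFactor (t • z) x * f (x - t • qPart z) - f x - t • hatS z f x‖ ≤ t ^ 2 * B x := by
    intro x t ht
    have hsub : ∀ s ∈ Set.uIcc 0 t, |s| ≤ |t| := fun s hs => by
      have := Set.abs_sub_left_of_mem_uIcc hs
      simpa using this
    have step : ∀ s ∈ Set.uIcc 0 t,
        ‖weylFactor (s • z) x * hatS z f (x - s • qPart z) - hatS z f x‖ ≤ B x * |t| := by
      intro s hs
      have := (convex_uIcc (0 : ℝ) t).norm_image_sub_le_of_norm_hasDerivWithin_le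
        (f := fun s : ℝ => weylFactor (s • z) x * hatS z f (x - s • qPart z)) (C := B x)
        (fun r hr => (hasDerivAt_weyl z (hatS z f) x r).hasDerivWithinAt)
        (fun r hr => by
          rw [norm_mul, norm_weylFactor, one_mul]
          exact hk x r ((hsub r hr).trans ht))
        Set.left_mem_uIcc hs
      simp only [h0', one_mul, zero_smul, sub_zero, Real.norm_eq_abs] at this
      exact this.trans (mul_le_mul_of_nonneg_left (hsub s hs) (hB0 x))
    have := (convex_uIcc (0 : ℝ) t).norm_image_sub_le_of_norm_hasDerivWithin_le
      (f := fun s : ℝ => weylFactor (s • z) x * f (x - s • qPart z) - s • hatS z f x)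
      (C := B x * |t|)
      (fun r hr => ((hasDerivAt_weyl z f x r).sub
        ((hasDerivAt_id r).smul_const (hatS z f x))).hasDerivWithinAt)
      (fun r hr => by simpa using step r hr)
      Set.left_mem_uIcc Set.right_mem_uIcc
    simp only [h0', one_mul, zero_smul, sub_zero, Real.norm_eq_abs] at this
    have e : weylFactor (t • z) x * f (x - t • qPart z) - f x - t • hatS z f x =
        weylFactor (t • z) x * f (x - t • qPart z) - t • hatS z f x - f x := by ring
    rw [e]
    refine this.trans (le_of_eq ?_)
    rw [← sq_abs t]
    ring
  have hL2 : ∀ t : ℝ, |t| ≤ 1 →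
      ‖displacement (t • z) (toHilb f) - toHilb f - t • toHilb (hatS z f)‖ ≤ t ^ 2 * ‖hB.toLp‖ := by
    intro t ht
    refine Lp.norm_le_mul_norm_of_ae_le_mul ?_
    have hf := SchwartzMap.coeFn_toLp f 2 (volume : Measure (Config N))
    have hg := SchwartzMap.coeFn_toLp (hatS z f) 2 (volume : Measure (Config N))
    have hf' := (measurePreserving_sub_right volume
      (qPart (t • z))).quasiMeasurePreserving.ae_eq_comp hf
    filter_upwards [hf, hg, hf', displacement_ae (t • z) (toHilb f), hB.coeFn_toLp,
      Lp.coeFn_sub (displacement (t • z) (toHilb f) - toHilb f) (t • toHilb (hatS z f)),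
      Lp.coeFn_sub (displacement (t • z) (toHilb f)) (toHilb f),
      Lp.coeFn_smul t (toHilb (hatS z f))] with x a1 a2 a3 a4 a5 a6 a7 a8
    simp only [Function.comp_apply] at a3
    change (toHilb f) x = f x at a1
    change (toHilb (hatS z f)) x = _ at a2
    change (toHilb f) (x - qPart (t • z)) = _ at a3
    rw [a6, Pi.sub_apply, a7, Pi.sub_apply, a8, Pi.smul_apply, a4, a1, a2, a3, a5,
      Real.norm_of_nonneg (hB0 x), hq]
    exact hpt x t ht
  have hz0 : displacement ((0 : ℝ) • z) (toHilb f) = toHilb f := by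
    refine Lp.ext ?_
    filter_upwards [displacement_ae ((0 : ℝ) • z) (toHilb f)] with x hx
    rw [hx, h0, hq]
    simp
  rw [hasDerivAt_iff_isLittleO]
  simp only [hz0, sub_zero]
  refine Asymptotics.IsBigO.trans_isLittleO (g := fun t : ℝ => t ^ 2) ?_ ?_
  · refine Asymptotics.IsBigO.of_bound ‖hB.toLp‖ ?_
    filter_upwards [Metric.ball_mem_nhds (0 : ℝ) one_pos] with t ht
    rw [mem_ball_zero_iff, Real.norm_eq_abs] at ht
    rw [norm_pow, Real.norm_eq_abs, sq_abs, mul_comm]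
    exact hL2 t ht.le
  · simpa using Asymptotics.isLittleO_pow_pow (𝕜 := ℝ) one_lt_two

end

noncomputable section

/-! Put `ψ = S φ`. Since `φ` is annihilated by `(1 + iJ)ξ`, covariance makes `ψ` annihilated by `(1
+ i T J T⁻¹)ξ`, and `T J T⁻¹ = Δ J`. Consider `F(t) = ⟨φ|D(tz)ψ⟩`. Its derivative is a combination
of the numbers `u_a = ⟨φ|D(tz) ξ^a ψ⟩`. Moving `ξ^a` to the left of `D(tz)` shifts `u_a` by `t z_a
F`, so the two annihilation conditions are linear equations for `u`, which invertibility of `1 + Δ`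
solves in terms of `t F` (`overlap_system_solution`). Hence `F' = t κ F`, and `F(1) = F(0) exp(κ/2)`
is the claimed Gaussian with its phase (`inner_displacement_eq`).

The modulus of `F(0)` comes from the orthogonality relation `∫ |⟨φ|D(z)ψ⟩|² dz = (2π)^N` for unit
vectors (`lintegral_enorm_inner_displacement_sq`, i.e. Plancherel in `p` and Tonelli in `q`).
Comparison with the Gaussian integral gives `|F(0)|² = √det(1 + Y)`. As `J` anticommutes with `Y`,
`det(1 - Y) = det(1 + Y)`, so `|F(0)| = det(1 - Y²)^{1/8}`; the normalization of `S` fixes the phase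
(`expVal_squeezing`).

The quadratures are unbounded and their domains are those of adjoints, so moving `ξ^a` across the
inner product needs self-adjointness. It is obtained from the unitary group `D(tz)` by
differentiating matrix elements (`ObsGraph.inner_eq`). -/

/-! ### Positive matrices: factorization and uniqueness of square roots. -/

open scoped MatrixOrder in
theorem exists_conjTranspose_mul_self_of_posSemidef {n : Type*} [Fintype n] {A : Matrix n n ℝ}
    (hA : A.PosSemidef) : ∃ B : Matrix n n ℝ, A = Bᴴ * B := by
  classical
  obtain ⟨B, hB⟩ := CStarAlgebra.nonneg_iff_eq_star_mul_self.mp hA.nonneg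
  exact ⟨B, hB⟩

/-- From `A² = B²`, the difference `D = A - B` anticommutes with `A + B`, so `D (A + B) D` has trace
zero. This trace is the squared Hilbert–Schmidt norm of `D` weighted by the positive forms `g⁻¹` and
`g (A + B)`, which forces `D = 0`. -/
theorem eq_of_mul_self_eq_of_posDef {n : Type*} [Fintype n] [DecidableEq n]
    {g A B : Matrix n n ℝ} (hg : g.PosDef) (hA : (g * A).PosDef) (hB : (g * B).PosDef)
    (h : A * A = B * B) : A = B := by
  obtain ⟨R, hR⟩ := exists_conjTranspose_mul_self_of_posSemidef hg.inv.posSemidef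
  obtain ⟨L, hL⟩ := exists_conjTranspose_mul_self_of_posSemidef (hA.add hB).posSemidef
  have hgu : IsUnit g := hg.isUnit
  have hgd : IsUnit g.det := (Matrix.isUnit_iff_isUnit_det g).1 hgu
  have hRu : IsUnit R.det := by
    have := (Matrix.isUnit_iff_isUnit_det _).1 hg.inv.isUnit
    rw [hR, Matrix.det_mul] at this
    exact isUnit_of_mul_isUnit_right this
  have hLu : IsUnit L.det := by
    have := (Matrix.isUnit_iff_isUnit_det _).1 (hA.add hB).isUnit
    rw [hL, Matrix.det_mul] at this
    exact isUnit_of_mul_isUnit_right this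
  set D := A - B with hD
  have hDsymm : Dᴴ * g = g * D := by
    have e1 := hA.isHermitian.eq
    have e2 := hB.isHermitian.eq
    have e3 := hg.isHermitian.eq
    rw [Matrix.conjTranspose_mul, e3] at e1 e2
    rw [hD, Matrix.conjTranspose_sub, sub_mul, mul_sub, e1, e2]
  have hanti : (A + B) * D = -(D * (A + B)) := by
    rw [hD]; linear_combination (norm := noncomm_ring) (2 : ℤ) • h
  have htr : (D * (A + B) * D).trace = 0 := by
    have h1 : (D * (A + B) * D).trace = (D * (D * (A + B))).trace := Matrix.trace_mul_comm _ _
    have h2 : (D * (A + B) * D).trace = -(D * (D * (A + B))).trace := by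
      rw [mul_assoc, hanti, mul_neg, Matrix.trace_neg]
    linarith
  -- With `g⁻¹ = Rᴴ R` and `g (A + B) = Lᴴ L`, the weighted norm is the ordinary one of `L D Rᴴ`;
  -- cyclicity of the trace then cancels `g` against `g⁻¹`.
  have key : (L * D * Rᴴ)ᴴ * (L * D * Rᴴ) = R * (g * D * (A + B) * D) * Rᴴ := by
    have : Lᴴ * L = g * (A + B) := by rw [← hL, mul_add]
    calc _ = R * (Dᴴ * (Lᴴ * L) * D) * Rᴴ := by
          simp only [Matrix.conjTranspose_mul, Matrix.conjTranspose_conjTranspose, mul_assoc]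
      _ = _ := by rw [this, ← mul_assoc Dᴴ, hDsymm]
  have hz : L * D * Rᴴ = 0 := by
    rw [← Matrix.trace_conjTranspose_mul_self_eq_zero_iff, key, Matrix.trace_mul_comm, ← mul_assoc,
      ← hR, ← htr]
    congr 1
    rw [mul_assoc g, mul_assoc g, ← mul_assoc, Matrix.nonsing_inv_mul _ hgd, one_mul]
  have hRu' : IsUnit (Rᴴ).det := by rw [Matrix.det_conjTranspose]; exact hRu.star
  have : D = 0 := by
    have h2 : L⁻¹ * (L * D * Rᴴ) * (Rᴴ)⁻¹ = D := by
      rw [mul_assoc L, ← mul_assoc, Matrix.nonsing_inv_mul _ hLu, one_mul, mul_assoc,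
        Matrix.mul_nonsing_inv _ hRu', mul_one]
    rw [← h2, hz]; simp
  exact sub_eq_zero.1 this

/-! ### Algebra of the Kähler triple, of `Δ_M`, and of its Cayley transform `Y_M`. -/

section KahlerAlgebra

variable {N : ℕ} {J M T : PhaseMat N}

theorem symOmegaInv_transpose (N : ℕ) : (symOmegaInv N)ᵀ = -symOmegaInv N := by
  simp [symOmegaInv, Matrix.fromBlocks_transpose, Matrix.fromBlocks_neg]

theorem det_symOmegaInv (N : ℕ) : (symOmegaInv N).det = 1 :=
  SymplecticGroup.det_eq_one (SymplecticGroup.J_mem (Fin N) ℝ)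

theorem kahlerInv_eq (hJ : IsGaussianStructure J) : kahlerInv J = symOmegaInv N * J := by
  refine Matrix.inv_eq_right_inv ?_
  rw [kahlerG, neg_mul, mul_assoc, ← mul_assoc (symOmega N), symOmega_mul_inv, one_mul, hJ.sq,
    neg_neg]

theorem kahlerInv_posDef (hJ : IsGaussianStructure J) : (kahlerInv J).PosDef := hJ.pos.inv

theorem kahlerInv_transpose (hJ : IsGaussianStructure J) : (kahlerInv J)ᵀ = kahlerInv J := by
  simpa using (kahlerInv_posDef hJ).isHermitian.eq

theorem kahlerInv_mul_J (hJ : IsGaussianStructure J) : kahlerInv J * J = -symOmegaInv N := by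
  rw [kahlerInv_eq hJ, mul_assoc, hJ.sq, mul_neg, mul_one]

theorem transpose_mul_kahlerInv (hJ : IsGaussianStructure J) :
    Jᵀ * kahlerInv J = -(kahlerInv J * J) := by
  have h := congrArg Matrix.transpose (kahlerInv_mul_J hJ)
  rw [Matrix.transpose_mul, kahlerInv_transpose hJ, Matrix.transpose_neg, symOmegaInv_transpose] at h
  rw [h, kahlerInv_mul_J hJ]

theorem isUnit_det_J (hJ : IsGaussianStructure J) : IsUnit J.det := by
  have h : J * (-J) = 1 := by rw [mul_neg, hJ.sq, neg_neg]
  exact Matrix.isUnit_det_of_right_inverse h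

theorem isUnit_det_kahlerInv (hJ : IsGaussianStructure J) : IsUnit (kahlerInv J).det :=
  (Matrix.isUnit_iff_isUnit_det _).1 (kahlerInv_posDef hJ).isUnit

theorem det_J_mul_self (hJ : IsGaussianStructure J) : J.det * J.det = 1 := by
  rw [← Matrix.det_mul, hJ.sq, Matrix.det_neg]
  simp [Fintype.card_sum]

/-- Since `g = ω J` and `det ω = 1`, `det g = det J = ±1`, and positivity of `g` selects the sign.
-/
theorem det_kahlerInv (hJ : IsGaussianStructure J) : (kahlerInv J).det = 1 := by
  have h1 : (kahlerInv J).det = J.det := by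
    rw [kahlerInv_eq hJ, Matrix.det_mul, det_symOmegaInv, one_mul]
  have h2 := (kahlerInv_posDef hJ).det_pos
  rw [h1] at h2 ⊢
  nlinarith [det_J_mul_self hJ]

theorem mul_symOmega_mul_transpose (hM : M ∈ Matrix.symplecticGroup (Fin N) ℝ) :
    M * symOmega N * Mᵀ = symOmega N := by
  have h := SymplecticGroup.mem_iff.1 hM
  have e : Matrix.J (Fin N) ℝ = -symOmega N := by
    simp [Matrix.J, symOmega, Matrix.fromBlocks_neg]
  rw [e] at h
  simpa using h

theorem deltaMat_eq_mul_metricTranspose (hJ : IsGaussianStructure J)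
    (hM : M ∈ Matrix.symplecticGroup (Fin N) ℝ) :
    deltaMat J M = M * metricTranspose J M := by
  have hi : M⁻¹ = symOmega N * Mᵀ * symOmegaInv N := by
    refine Matrix.inv_eq_right_inv ?_
    rw [← mul_assoc, ← mul_assoc, mul_symOmega_mul_transpose hM, symOmega_mul_inv]
  rw [deltaMat, metricTranspose, hi, kahlerG, kahlerInv_eq hJ]
  simp only [mul_assoc, neg_mul, mul_neg]

theorem deltaMat_mul_inv (hJ : IsGaussianStructure J) (hM : IsUnit M.det) :
    deltaMat J M * -(J * M * J * M⁻¹) = 1 := by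
  have h1 : M * M⁻¹ = 1 := Matrix.mul_nonsing_inv _ hM
  have h2 : M⁻¹ * M = 1 := Matrix.nonsing_inv_mul _ hM
  rw [deltaMat, neg_mul_neg]
  calc _ = M * J * M⁻¹ * (J * J) * (M * J * M⁻¹) := by simp only [mul_assoc]
    _ = -(M * J * (M⁻¹ * M) * J * M⁻¹) := by rw [hJ.sq]; noncomm_ring
    _ = -(M * (J * J) * M⁻¹) := by rw [h2]; noncomm_ring
    _ = 1 := by rw [hJ.sq]; simp [h1]

theorem deltaMat_inv (hJ : IsGaussianStructure J) (hM : IsUnit M.det) :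
    (deltaMat J M)⁻¹ = -(J * M * J * M⁻¹) := Matrix.inv_eq_right_inv (deltaMat_mul_inv hJ hM)

theorem isUnit_det_deltaMat (hJ : IsGaussianStructure J) (hM : IsUnit M.det) :
    IsUnit (deltaMat J M).det := Matrix.isUnit_det_of_right_inverse (deltaMat_mul_inv hJ hM)

theorem isUnit_det_posSqrt {A : PhaseMat N} (hT : IsPosSqrt J A T) :
    IsUnit T.det := by
  have h := (Matrix.isUnit_iff_isUnit_det _).1 hT.pos.isUnit
  rw [Matrix.det_mul] at h
  exact isUnit_of_mul_isUnit_right h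

theorem transpose_mul_kahlerInv_posSqrt (hJ : IsGaussianStructure J) {A : PhaseMat N}
    (hT : IsPosSqrt J A T) : Tᵀ * kahlerInv J = kahlerInv J * T := by
  have h := hT.pos.isHermitian.eq
  simpa [Matrix.conjTranspose_eq_transpose_of_trivial, Matrix.transpose_mul,
    kahlerInv_transpose hJ] using h

/-- Self-adjointness of `T` gives `g T² = Tᵗ g T`, a congruence of `g`. -/
theorem posDef_kahlerInv_mul (hJ : IsGaussianStructure J) {A : PhaseMat N}
    (hT : IsPosSqrt J A T) : (kahlerInv J * A).PosDef := by
  have hTu := (Matrix.isUnit_iff_isUnit_det T).2 (isUnit_det_posSqrt hT)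
  have h := ((Matrix.IsUnit.posDef_star_left_conjugate_iff hTu).2 (kahlerInv_posDef hJ))
  rw [Matrix.star_eq_conjTranspose, Matrix.conjTranspose_eq_transpose_of_trivial,
    transpose_mul_kahlerInv_posSqrt hJ hT, mul_assoc, hT.sq] at h
  exact h

/-- The positive square root of `Δ_M` satisfies `J T⁻¹ = T J`, i.e. it is symplectic. -/
theorem J_mul_inv_posSqrt (hJ : IsGaussianStructure J) (hM : IsUnit M.det)
    (hT : IsPosSqrt J (deltaMat J M) T) : J * T⁻¹ = T * J := by
  have hTd := isUnit_det_posSqrt hT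
  have hTu := (Matrix.isUnit_iff_isUnit_det T).2 hTd
  have hgd := isUnit_det_kahlerInv hJ
  have h1 : T⁻¹ * T⁻¹ = (deltaMat J M)⁻¹ := by rw [← hT.sq, Matrix.mul_inv_rev]
  -- Because `-J Δ⁻¹ J = Δ`, the matrix `-J T⁻¹ J` is another square root of `Δ`; once it is known
  -- to be `g`-positive, uniqueness identifies it with `T`.
  have h2 : -(J * T⁻¹ * J) * -(J * T⁻¹ * J) = T * T := by
    calc _ = J * T⁻¹ * (J * J) * T⁻¹ * J := by noncomm_ring
      _ = -(J * (T⁻¹ * T⁻¹) * J) := by rw [hJ.sq]; noncomm_ring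
      _ = (J * J) * M * J * M⁻¹ * J := by rw [h1, deltaMat_inv hJ hM]; noncomm_ring
      _ = T * T := by rw [hJ.sq, hT.sq, deltaMat]; noncomm_ring
  have h3 : (kahlerInv J * T⁻¹).PosDef := by
    have h := ((Matrix.IsUnit.posDef_star_left_conjugate_iff
      (kahlerInv_posDef hJ).isUnit).2 hT.pos.inv)
    rw [Matrix.star_eq_conjTranspose, (kahlerInv_posDef hJ).isHermitian.eq, Matrix.mul_inv_rev,
      mul_assoc, mul_assoc, Matrix.nonsing_inv_mul _ hgd, mul_one] at h
    exact h
  -- As `Jᵗ g = -g J`, this matrix is the congruence `Jᵗ (g T⁻¹) J`.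
  have h4 : (kahlerInv J * -(J * T⁻¹ * J)).PosDef := by
    have h := ((Matrix.IsUnit.posDef_star_left_conjugate_iff
      ((Matrix.isUnit_iff_isUnit_det J).2 (isUnit_det_J hJ))).2 h3)
    rw [Matrix.star_eq_conjTranspose, Matrix.conjTranspose_eq_transpose_of_trivial, ← mul_assoc,
      transpose_mul_kahlerInv hJ] at h
    convert h using 1
    noncomm_ring
  have h5 := eq_of_mul_self_eq_of_posDef (kahlerInv_posDef hJ) h4 hT.pos h2
  calc J * T⁻¹ = -(J * T⁻¹ * (J * J)) := by rw [hJ.sq]; simp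
    _ = -(J * T⁻¹ * J) * J := by noncomm_ring
    _ = T * J := by rw [h5]

theorem posSqrt_conj_J (hJ : IsGaussianStructure J) (hM : IsUnit M.det)
    (hT : IsPosSqrt J (deltaMat J M) T) : T * J * T⁻¹ = deltaMat J M * J := by
  rw [mul_assoc, J_mul_inv_posSqrt hJ hM hT, ← mul_assoc, hT.sq]

theorem posDef_kahlerInv_mul_one_add (hJ : IsGaussianStructure J)
    (hT : IsPosSqrt J (deltaMat J M) T) : (kahlerInv J * (1 + deltaMat J M)).PosDef := by
  rw [mul_add, mul_one]
  exact (kahlerInv_posDef hJ).add (posDef_kahlerInv_mul hJ hT)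

theorem isUnit_one_add_deltaMat (hJ : IsGaussianStructure J)
    (hT : IsPosSqrt J (deltaMat J M) T) : IsUnit (1 + deltaMat J M) := by
  have h := (Matrix.isUnit_iff_isUnit_det _).1 (posDef_kahlerInv_mul_one_add hJ hT).isUnit
  rw [Matrix.det_mul] at h
  exact (Matrix.isUnit_iff_isUnit_det _).2 (isUnit_of_mul_isUnit_right h)

theorem yMat_eq (hJ : IsGaussianStructure J) (hT : IsPosSqrt J (deltaMat J M) T) :
    yMat J M = (2 : ℝ) • (1 + deltaMat J M)⁻¹ - 1 := by
  have h := Matrix.mul_nonsing_inv _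
    ((Matrix.isUnit_iff_isUnit_det _).1 (isUnit_one_add_deltaMat hJ hT))
  have e : 1 - deltaMat J M = (2 : ℝ) • 1 - (1 + deltaMat J M) := by
    rw [two_smul]; abel
  rw [yMat, e, sub_mul, h, smul_mul_assoc, one_mul]

theorem one_add_yMat (hJ : IsGaussianStructure J) (hT : IsPosSqrt J (deltaMat J M) T) :
    1 + yMat J M = (2 : ℝ) • (1 + deltaMat J M)⁻¹ := by
  rw [yMat_eq hJ hT]; abel

theorem mul_linPart_inv (hM : IsUnit M.det) :
    M * linPart J M⁻¹ = (1 / 2 : ℝ) • (1 + deltaMat J M) := by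
  rw [linPart, deltaMat, mul_smul_comm, mul_sub, Matrix.mul_nonsing_inv _ hM, sub_eq_add_neg]
  simp only [mul_assoc]

theorem mul_antilinPart_inv (hM : IsUnit M.det) :
    M * antilinPart J M⁻¹ = (1 / 2 : ℝ) • (1 - deltaMat J M) := by
  rw [antilinPart, deltaMat, mul_smul_comm, mul_add, Matrix.mul_nonsing_inv _ hM, sub_neg_eq_add]
  simp only [mul_assoc]

theorem isUnit_linPart_inv (hM : IsUnit M.det) (h : IsUnit (1 + deltaMat J M)) :
    IsUnit (linPart J M⁻¹) := by
  have h1 : IsUnit (M * linPart J M⁻¹).det := by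
    rw [mul_linPart_inv hM, Matrix.det_smul]
    exact (IsUnit.mk0 _ (by positivity)).mul ((Matrix.isUnit_iff_isUnit_det _).1 h)
  rw [Matrix.det_mul] at h1
  exact (Matrix.isUnit_iff_isUnit_det _).2 (isUnit_of_mul_isUnit_right h1)

/-- Left multiplication by `M` turns the linear and antilinear parts of `M⁻¹` into `(1 + Δ)/2` and
`(1 - Δ)/2`; in the quotient `C⁻¹ D` the factor `M` drops out. -/
theorem yMat_eq_zMat_inv (hM : IsUnit M.det) (h : IsUnit (1 + deltaMat J M)) :
    yMat J M = zMat J M⁻¹ := by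
  have hd := (Matrix.isUnit_iff_isUnit_det _).1 h
  have hL := (Matrix.isUnit_iff_isUnit_det _).1 (isUnit_linPart_inv (J := J) hM h)
  have hc : linPart J M⁻¹ * yMat J M = antilinPart J M⁻¹ := by
    have h1 : M * (linPart J M⁻¹ * yMat J M) = M * antilinPart J M⁻¹ := by
      rw [← mul_assoc, mul_linPart_inv hM, mul_antilinPart_inv hM, smul_mul_assoc, yMat,
        ← mul_assoc]
      have : (1 + deltaMat J M) * (1 - deltaMat J M) = (1 - deltaMat J M) * (1 + deltaMat J M) := by
        noncomm_ring
      rw [this, mul_assoc, Matrix.mul_nonsing_inv _ hd, mul_one]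
    have h2 := congrArg (M⁻¹ * ·) h1
    simpa only [← mul_assoc, Matrix.nonsing_inv_mul _ hM, one_mul] using h2
  rw [zMat, ← hc, ← mul_assoc, Matrix.nonsing_inv_mul _ hL, one_mul]

/-- Conjugation by `J` inverts `Δ`, and the Cayley transform is odd under inversion, so `J`
anticommutes with `Y`. -/
theorem J_mul_yMat_mul_J (hJ : IsGaussianStructure J) (hM : IsUnit M.det)
    (hT : IsPosSqrt J (deltaMat J M) T) : J * yMat J M * J = yMat J M := by
  have hd := (Matrix.isUnit_iff_isUnit_det _).1 (isUnit_one_add_deltaMat hJ hT)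
  have hΔ := isUnit_det_deltaMat hJ hM
  set Δ := deltaMat J M with hΔdef
  set W := (1 + Δ)⁻¹ with hW
  have h1 : (1 + Δ) * W = 1 := Matrix.mul_nonsing_inv _ hd
  have h1' : W * (1 + Δ) = 1 := Matrix.nonsing_inv_mul _ hd
  have h2 : J * Δ * J = -Δ⁻¹ := by
    rw [hΔdef, deltaMat_inv hJ hM, deltaMat]
    calc _ = -(J * M * J * M⁻¹ * (J * J)) := by noncomm_ring
      _ = _ := by rw [hJ.sq]; noncomm_ring
  have h3 : Δ * Δ⁻¹ = 1 := Matrix.mul_nonsing_inv _ hΔ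
  -- `J (1 + Δ) J = -Δ⁻¹ (1 + Δ)`
  have h4 : J * (1 + Δ) * J = -(Δ⁻¹ * (1 + Δ)) := by
    rw [mul_add, add_mul, h2, mul_one, hJ.sq, mul_add, Matrix.nonsing_inv_mul _ hΔ]
    noncomm_ring
  have h5 : J * W * J = W - 1 := by
    have e1 : (J * (1 + Δ) * J) * (J * W * J) = 1 := by
      calc _ = J * (1 + Δ) * (J * J) * W * J := by simp only [mul_assoc]
        _ = -(J * ((1 + Δ) * W) * J) := by rw [hJ.sq]; noncomm_ring
        _ = 1 := by rw [h1, mul_one, hJ.sq, neg_neg]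
    have e2 : (W * Δ) * (Δ⁻¹ * (1 + Δ)) = 1 := by
      rw [mul_assoc, ← mul_assoc Δ, h3, one_mul, h1']
    have e3 : J * W * J = -(W * Δ) := by
      rw [h4] at e1
      calc _ = W * Δ * (Δ⁻¹ * (1 + Δ)) * (J * W * J) := by rw [e2, one_mul]
        _ = -(W * Δ * (-(Δ⁻¹ * (1 + Δ)) * (J * W * J))) := by noncomm_ring
        _ = _ := by rw [e1, mul_one]
    rw [e3, eq_sub_iff_add_eq, neg_add_eq_iff_eq_add, ← h1', mul_add, mul_one, add_comm]
  have hY : yMat J M = (2 : ℝ) • W - 1 := yMat_eq hJ hT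
  rw [hY, mul_sub, sub_mul, mul_smul_comm, smul_mul_assoc, h5, mul_one, hJ.sq, smul_sub, two_smul,
    two_smul]
  abel

/-- Anticommutation of `J` and `Y` gives `J (1 - Y) J = -(1 + Y)`. In even dimension the sign is
harmless, so both factors of `1 - Y²` have the same determinant. -/
theorem det_one_sub_yMat_sq (hJ : IsGaussianStructure J) (hM : IsUnit M.det)
    (hT : IsPosSqrt J (deltaMat J M) T) :
    (1 - yMat J M ^ 2).det = (1 + yMat J M).det ^ 2 := by
  have h1 : J * (1 - yMat J M) * J = -(1 + yMat J M) := by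
    rw [mul_sub, sub_mul, J_mul_yMat_mul_J hJ hM hT, mul_one, hJ.sq]; abel
  have h2 := congrArg Matrix.det h1
  rw [Matrix.det_mul, Matrix.det_mul, Matrix.det_neg, mul_right_comm, det_J_mul_self hJ] at h2
  have h3 : (1 - yMat J M).det = (1 + yMat J M).det := by
    simpa [Fintype.card_sum] using h2
  have h4 : 1 - yMat J M ^ 2 = (1 - yMat J M) * (1 + yMat J M) := by noncomm_ring
  rw [h4, Matrix.det_mul, h3, sq]

theorem posDef_kahlerInv_mul_one_add_yMat (hJ : IsGaussianStructure J)
    (hT : IsPosSqrt J (deltaMat J M) T) : (kahlerInv J * (1 + yMat J M)).PosDef := by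
  have hgd := isUnit_det_kahlerInv hJ
  have h := ((Matrix.IsUnit.posDef_star_left_conjugate_iff
      (kahlerInv_posDef hJ).isUnit).2 (posDef_kahlerInv_mul_one_add hJ hT).inv)
  rw [Matrix.star_eq_conjTranspose, (kahlerInv_posDef hJ).isHermitian.eq, Matrix.mul_inv_rev,
      mul_assoc, mul_assoc, Matrix.nonsing_inv_mul _ hgd, mul_one] at h
  rw [one_add_yMat hJ hT, mul_smul_comm]
  exact h.smul (by norm_num)

theorem det_one_add_yMat_pos (hJ : IsGaussianStructure J)
    (hT : IsPosSqrt J (deltaMat J M) T) : 0 < (1 + yMat J M).det := by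
  have h := (posDef_kahlerInv_mul_one_add_yMat hJ hT).det_pos
  rwa [Matrix.det_mul, det_kahlerInv hJ, one_mul] at h

end KahlerAlgebra

/-! ### Displacements on Schwartz space and their commutation with the quadratures. -/

section SchwartzDisplacement

variable {N : ℕ}

theorem hasTemperateGrowth_cexp_I_mul : (fun t : ℝ => cexp (I * t)).HasTemperateGrowth := by
  refine ⟨contDiff_exp.comp (contDiff_const.mul ofRealCLM.contDiff), fun n => ⟨0, 1, fun t => ?_⟩⟩
  have h : ∀ n, iteratedDeriv n (fun t : ℝ => cexp (I * t)) = fun t : ℝ => I ^ n * cexp (I * t) := by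
    intro n
    induction n with
    | zero => simp
    | succ n ih =>
      rw [iteratedDeriv_succ, ih]
      funext t
      have h1 : HasDerivAt (fun t : ℝ => (t : ℂ)) 1 t := Complex.ofRealCLM.hasDerivAt
      have h2 := ((h1.const_mul I).cexp).const_mul (I ^ n)
      rw [h2.deriv]
      ring
  rw [norm_iteratedFDeriv_eq_norm_iteratedDeriv, h]
  simp [Complex.norm_exp]

theorem hasTemperateGrowth_weylFactor (z : PhaseVec N) : (weylFactor z).HasTemperateGrowth := by
  have h1 : (fun x : Config N => ∑ j, z (Sum.inr j) * x j).HasTemperateGrowth := by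
    have h := (∑ j, z (Sum.inr j) • (EuclideanSpace.proj j : Config N →L[ℝ] ℝ)).hasTemperateGrowth
    convert h using 1
    funext x
    simp [_root_.sum_apply]
  have h2 := hasTemperateGrowth_cexp_I_mul.comp
    (h1.sub (.const ((1 / 2) * ∑ j, z (Sum.inl j) * z (Sum.inr j))))
  convert h2 using 1
  funext x
  simp only [weylFactor, Function.comp_apply, Pi.sub_apply]
  congr 1
  push_cast
  ring

/-- The displacement operator on Schwartz functions. -/
def displacementS (z : PhaseVec N) : 𝓢(Config N, ℂ) →L[ℂ] 𝓢(Config N, ℂ) :=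
  SchwartzMap.smulLeftCLM ℂ (weylFactor z) ∘L SchwartzMap.compSubConstCLM ℂ (qPart z)

theorem displacementS_apply (z : PhaseVec N) (f : 𝓢(Config N, ℂ)) (x : Config N) :
    displacementS z f x = weylFactor z x * f (x - qPart z) := by
  simp [displacementS, SchwartzMap.smulLeftCLM_apply_apply (hasTemperateGrowth_weylFactor z)]

theorem toHilb_displacementS (z : PhaseVec N) (f : 𝓢(Config N, ℂ)) :
    toHilb (displacementS z f) = displacement z (toHilb f) := by
  refine Lp.ext ?_
  have h := (measurePreserving_sub_right volume (qPart z)).quasiMeasurePreserving.ae_eq_comp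
    (SchwartzMap.coeFn_toLp f 2 (volume : Measure (Config N)))
  filter_upwards [displacement_ae z (toHilb f), h,
    SchwartzMap.coeFn_toLp (displacementS z f) 2 (volume : Measure (Config N))] with x h1 h2 h3
  simp only [Function.comp_apply] at h2
  rw [h1]
  change (displacementS z f).toLp 2 volume x = _ * f.toLp 2 volume _
  rw [h2, h3, displacementS_apply]

theorem fderiv_weylFactor (z : PhaseVec N) (x v : Config N) :
    fderiv ℝ (weylFactor z) x v = I * ((∑ j, z (Sum.inr j) * v j : ℝ) : ℂ) * weylFactor z x := by
  have h1 : HasFDerivAt (fun x : Config N => ((∑ j, z (Sum.inr j) * x j : ℝ) : ℂ))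
      (Complex.ofRealCLM ∘L ∑ j, z (Sum.inr j) • (EuclideanSpace.proj j : Config N →L[ℝ] ℝ)) x := by
    convert (Complex.ofRealCLM ∘L
      ∑ j, z (Sum.inr j) • (EuclideanSpace.proj j : Config N →L[ℝ] ℝ)).hasFDerivAt using 1
    funext x
    simp [_root_.sum_apply]
  have h2 := ((h1.const_mul I).sub_const
    (I / 2 * ((∑ j, z (Sum.inl j) * z (Sum.inr j) : ℝ) : ℂ))).cexp
  have h3 : fderiv ℝ (weylFactor z) x = _ := h2.fderiv
  rw [h3]
  simp [_root_.sum_apply, weylFactor]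
  ring

theorem xiS_displacementS (a : Quad N) (z : PhaseVec N) (f : 𝓢(Config N, ℂ)) :
    xiS a (displacementS z f) = displacementS z (xiS a f + (z a : ℂ) • f) := by
  ext x
  rw [displacementS_apply]
  rcases a with j | j
  · rw [_root_.add_apply, _root_.smul_apply, xiS_inl_apply, xiS_inl_apply,
      displacementS_apply]
    simp [qPart]
    ring
  · rw [_root_.add_apply, _root_.smul_apply, xiS_inr_apply, xiS_inr_apply]
    have hw : DifferentiableAt ℝ (weylFactor z) x :=
      ((hasTemperateGrowth_weylFactor z).1.differentiable (by simp)) x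
    have hf : HasFDerivAt (fun x => f (x - qPart z)) (fderiv ℝ f (x - qPart z)) x := by
      exact (f.hasFDerivAt (x - qPart z)).comp x ((hasFDerivAt_id x).sub_const (qPart z))
    have he : (displacementS z f : Config N → ℂ) = fun x => weylFactor z x * f (x - qPart z) :=
      funext (displacementS_apply z f)
    rw [he, fderiv_fun_mul hw hf.differentiableAt, hf.fderiv]
    simp only [FunLike.coe_add, Pi.add_apply, FunLike.coe_smul, Pi.smul_apply, fderiv_weylFactor,
      smul_eq_mul]
    simp
    linear_combination (-(z (Sum.inr j)) * weylFactor z x * f (x - qPart z)) * I_mul_I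

theorem obsS_displacementS (w z : PhaseVec N) (f : 𝓢(Config N, ℂ)) :
    obsS w (displacementS z f) = displacementS z (obsS w f + ((w ⬝ᵥ z : ℝ) : ℂ) • f) := by
  simp only [obsS, _root_.sum_apply, _root_.smul_apply, xiS_displacementS,
    map_add, map_sum, map_smul, smul_add, Finset.sum_add_distrib, dotProduct]
  push_cast
  rw [Finset.sum_smul]
  simp only [smul_smul]

end SchwartzDisplacement

/-! ### Matrix elements of the displacement group and symmetry of the quadratures. -/

section WeakDerivative

variable {N : ℕ}

theorem displacement_zero (u : Hilb N) : displacement (0 : PhaseVec N) u = u := by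
  refine Lp.ext ?_
  filter_upwards [displacement_ae (0 : PhaseVec N) u] with x hx
  have h : qPart (0 : PhaseVec N) = 0 := by ext; simp [qPart]
  rw [hx, h]
  simp [weylFactor]

theorem displacement_neg_displacement (z : PhaseVec N) (u : Hilb N) :
    displacement (-z) (displacement z u) = u := by
  have h := displacement_add z (-1) 1 u
  simpa [displacement_zero] using h

theorem inner_displacement_right (z : PhaseVec N) (u v : Hilb N) :
    inner ℂ u (displacement z v) = inner ℂ (displacement (-z) u) v := by
  rw [← (displacement (-z)).inner_map_map u, displacement_neg_displacement]

theorem exists_seq_toHilb_tendsto (χ : Hilb N) :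
    ∃ h : ℕ → 𝓢(Config N, ℂ), Filter.Tendsto (fun n => toHilb (h n)) Filter.atTop (nhds χ) := by
  have hd := (SchwartzMap.denseRange_toLpCLM (E := Config N) (F := ℂ) (p := 2)
    (μ := volume) ENNReal.ofNat_ne_top) χ
  obtain ⟨s, hs, hlim⟩ := mem_closure_iff_seq_limit.1 hd
  choose h hh using hs
  exact ⟨h, hlim.congr fun n => (hh n).symm⟩

theorem toHilb_smul (c : ℂ) (f : 𝓢(Config N, ℂ)) : toHilb (c • f) = c • toHilb f :=
  (SchwartzMap.toLpCLM ℂ ℂ 2 (volume : Measure (Config N))).map_smul c f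

theorem toHilb_add (f g : 𝓢(Config N, ℂ)) : toHilb (f + g) = toHilb f + toHilb g :=
  (SchwartzMap.toLpCLM ℂ ℂ 2 (volume : Measure (Config N))).map_add f g

theorem ObsGraph.sum {φ : Hilb N} {η : Quad N → Hilb N} (h : ∀ a, XiGraph a φ (η a))
    (w : PhaseVec N) : ObsGraph w φ (∑ a, (w a : ℂ) • η a) := by
  intro f
  have h1 : toHilb (obsS w f) = ∑ a, (w a : ℂ) • toHilb (xiS a f) := by
    have := map_sum (SchwartzMap.toLpCLM ℂ ℂ 2 (volume : Measure (Config N)))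
      (fun a => (w a : ℂ) • xiS a f) Finset.univ
    simp only [map_smul, SchwartzMap.toLpCLM_apply] at this
    rw [← show _ = toHilb (obsS w f) from rfl, toHilb, obsS, _root_.sum_apply]
    exact this
  have h2 : ∀ a, inner ℂ (toHilb (xiS a f)) φ = inner ℂ (toHilb f) (η a) := by
    intro a
    have := h a f
    have e : obsS (Pi.single a 1) f = xiS a f := by
      rw [obsS, _root_.sum_apply, Finset.sum_eq_single a]
      · simp
      · intro b _ hb; simp [hb]
      · simp
    rwa [e] at this
  rw [h1, sum_inner, inner_sum]
  refine Finset.sum_congr rfl fun a _ => ?_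
  rw [inner_smul_left, inner_smul_right, h2, Complex.conj_ofReal]

/-- The relation `D(z)† ξ D(z) = ξ + z` extends from Schwartz functions to the domain of the adjoint
by transferring `D(z)` to the test function as `D(-z)`. -/
theorem ObsGraph.displaced {w : PhaseVec N} {ψ θ : Hilb N} (h : ObsGraph w ψ θ)
    (z : PhaseVec N) :
    ObsGraph w (displacement z ψ) (displacement z (θ + ((w ⬝ᵥ z : ℝ) : ℂ) • ψ)) := by
  intro f
  rw [inner_displacement_right, inner_displacement_right, ← toHilb_displacementS,
    ← toHilb_displacementS, inner_add_right, inner_smul_right]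
  have h1 : displacementS (-z) (obsS w f) =
      obsS w (displacementS (-z) f) + ((w ⬝ᵥ z : ℝ) : ℂ) • displacementS (-z) f := by
    rw [obsS_displacementS, map_add, map_smul, dotProduct_neg]
    push_cast
    rw [neg_smul]
    abel
  rw [h1, toHilb_add, toHilb_smul, inner_add_left, inner_smul_left, h, Complex.conj_ofReal]

theorem hasDerivAt_displacement_toHilb (z : PhaseVec N) (f : 𝓢(Config N, ℂ)) (t : ℝ) :
    HasDerivAt (fun s : ℝ => displacement (s • z) (toHilb f))
      (toHilb (hatS z (displacementS (t • z) f))) t := by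
  -- The group law carries the derivative at `0` to time `t`, because `D(tz) f` is again a Schwartz
  -- function.
  have h := displacement_hasDerivAt z (displacementS (t • z) f)
  rw [← sub_self t] at h
  have h2 := HasDerivAt.scomp (h := fun s => s - t) t h ((hasDerivAt_id' t).sub_const t)
  rw [one_smul] at h2
  refine h2.congr_of_eventuallyEq (Filter.Eventually.of_forall fun s => ?_)
  simp only [Function.comp_apply, toHilb_displacementS]
  rw [displacement_add, sub_add_cancel]

theorem hasDerivAt_inner_toHilb_displacement {z : PhaseVec N} {ψ θ : Hilb N}
    (h : ObsGraph (z ᵥ* symOmegaInv N) ψ θ) (f : 𝓢(Config N, ℂ)) (t : ℝ) :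
    HasDerivAt (fun s : ℝ => inner ℂ (toHilb f) (displacement (s • z) ψ))
      (inner ℂ (toHilb f) (displacement (t • z) (I • θ))) t := by
  have h1 := (hasDerivAt_displacement_toHilb z f (-t)).scomp t (hasDerivAt_neg t)
  have h2 := h1.inner ℂ (hasDerivAt_const t ψ)
  simp only [Function.comp_def] at h2
  have h3 : (fun s : ℝ => inner ℂ (toHilb f) (displacement (s • z) ψ)) =
      fun s : ℝ => inner ℂ (displacement (-s • z) (toHilb f)) ψ := by
    funext s
    rw [inner_displacement_right, neg_smul]
  rw [h3]
  refine h2.congr_deriv (Eq.symm ?_)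
  · rw [inner_zero_right, zero_add, inner_displacement_right, ← neg_smul, ← toHilb_displacementS]
    rw [neg_one_smul, inner_neg_left]
    simp only [hatS, _root_.smul_apply]
    rw [toHilb_smul, inner_smul_left, h, inner_smul_right]
    simp

/-- For Schwartz `χ` the group can be moved onto `χ`. In general `χ` is approximated; the
derivatives converge uniformly in time, since `D` is isometric and the error is at most `‖χ - f_n‖
‖θ‖`. -/
theorem hasDerivAt_inner_displacement {z : PhaseVec N} {ψ θ : Hilb N}
    (h : ObsGraph (z ᵥ* symOmegaInv N) ψ θ) (χ : Hilb N) (t : ℝ) :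
    HasDerivAt (fun s : ℝ => inner ℂ χ (displacement (s • z) ψ))
      (inner ℂ χ (displacement (t • z) (I • θ))) t := by
  obtain ⟨f, hf⟩ := exists_seq_toHilb_tendsto χ
  refine hasDerivAt_of_tendstoUniformly (l := Filter.atTop)
    (f := fun n (s : ℝ) => inner ℂ (toHilb (f n)) (displacement (s • z) ψ))
    (f' := fun n (s : ℝ) => inner ℂ (toHilb (f n)) (displacement (s • z) (I • θ)))
    (g' := fun s : ℝ => inner ℂ χ (displacement (s • z) (I • θ))) ?_
    (Filter.Eventually.of_forall fun n s => hasDerivAt_inner_toHilb_displacement h (f n) s)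
    (fun s => hf.inner tendsto_const_nhds) t
  have h0 : Filter.Tendsto (fun n => ‖χ - toHilb (f n)‖ * ‖θ‖) Filter.atTop (nhds 0) := by
    have h1 := (tendsto_const_nhds (x := χ)).sub hf
    simpa using h1.norm.mul_const ‖θ‖
  rw [Metric.tendstoUniformly_iff]
  intro ε hε
  filter_upwards [h0.eventually_lt_const hε] with n hn s
  rw [dist_eq_norm, ← inner_sub_left]
  refine (norm_inner_le_norm _ _).trans_lt ?_
  rw [LinearIsometry.norm_map, norm_smul, norm_I, one_mul]
  exact hn

/-- Adjoints of linear observables are symmetric. -/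
theorem ObsGraph.inner_eq {w : PhaseVec N} {φ η ψ θ : Hilb N} (hφ : ObsGraph w φ η)
    (hψ : ObsGraph w ψ θ) : inner ℂ η ψ = inner ℂ φ θ := by
  set z : PhaseVec N := w ᵥ* symOmega N with hz
  have hw : z ᵥ* symOmegaInv N = w := by
    rw [hz, Matrix.vecMul_vecMul, symOmega_mul_inv, Matrix.vecMul_one]
  rw [← hw] at hφ hψ
  have h1 := hasDerivAt_inner_displacement hψ φ 0
  have h2 := hasDerivAt_inner_displacement hφ ψ (-0)
  have h3 := (h2.scomp (0 : ℝ) (hasDerivAt_neg (0 : ℝ))).star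
  -- The same function is differentiated with the group acting on `ψ` and, after conjugation, with
  -- the inverse group acting on `φ`; the two derivatives at `0` must agree.
  have h4 : (fun s : ℝ => inner ℂ φ (displacement (s • z) ψ)) =
      fun s => star (((fun s : ℝ => inner ℂ ψ (displacement (s • z) φ)) ∘ Neg.neg) s) := by
    funext s
    rw [inner_displacement_right, Function.comp_apply, RCLike.star_def, inner_conj_symm, neg_smul]
  rw [h4] at h1
  have h5 := h1.unique h3
  simp only [neg_zero, zero_smul, displacement_zero, inner_smul_right] at h5
  simp at h5
  exact h5.symm

end WeakDerivative

/-! ### The differential equation for the overlap of two Gaussian states. -/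

section Overlap

variable {N : ℕ} {J M T : PhaseMat N}

/-- The entrywise complexification of a real matrix. -/
def complexMat (A : PhaseMat N) : Matrix (Quad N) (Quad N) ℂ := A.map (fun r : ℝ => (r : ℂ))

theorem complexMat_mul (A B : PhaseMat N) :
    complexMat (A * B) = complexMat A * complexMat B :=
  Matrix.map_mul (f := Complex.ofRealHom)

theorem complexMat_add (A B : PhaseMat N) :
    complexMat (A + B) = complexMat A + complexMat B := by
  ext; simp [complexMat]

theorem complexMat_neg (A : PhaseMat N) : complexMat (-A) = -complexMat A := by
  ext; simp [complexMat]

theorem complexMat_one : complexMat (1 : PhaseMat N) = 1 := by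
  ext i j; by_cases h : i = j <;> simp [complexMat, h, Matrix.one_apply]

theorem complexMat_mulVec_ofReal (A : PhaseMat N) (z : PhaseVec N) :
    complexMat A *ᵥ (fun a => (z a : ℂ)) = fun a => ((A *ᵥ z) a : ℂ) := by
  ext a; simp [complexMat, Matrix.mulVec, dotProduct]

theorem ofReal_dotProduct (x y : PhaseVec N) :
    (fun a => (x a : ℂ)) ⬝ᵥ (fun a => (y a : ℂ)) = ((x ⬝ᵥ y : ℝ) : ℂ) := by
  simp [dotProduct]

theorem bil_mul (A B : PhaseMat N) (z w : PhaseVec N) : bil (A * B) z w = (z ᵥ* A) ⬝ᵥ (B *ᵥ w) := by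
  rw [bil, ← Matrix.mulVec_mulVec, Matrix.dotProduct_mulVec]

theorem bil_add (A B : PhaseMat N) (z w : PhaseVec N) : bil (A + B) z w = bil A z w + bil B z w := by
  simp [bil, Matrix.add_mulVec, dotProduct_add]

theorem bil_smul (c : ℝ) (A : PhaseMat N) (z w : PhaseVec N) :
    bil (c • A) z w = c * bil A z w := by
  simp [bil, Matrix.smul_mulVec, dotProduct_smul]

theorem bil_symOmegaInv_self (z : PhaseVec N) : bil (symOmegaInv N) z z = 0 := by
  have h : bil (symOmegaInv N) z z = -bil (symOmegaInv N) z z := by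
    conv_lhs => rw [bil, Matrix.dotProduct_mulVec, ← Matrix.mulVec_transpose, symOmegaInv_transpose,
      Matrix.neg_mulVec, neg_dotProduct, dotProduct_comm]
    rfl
  linarith

/-- The first-order system satisfied by the overlaps with `u_a = ⟨φ|D(z) ξ^a ψ⟩` and
`v_a = ⟨φ|ξ^a D(z) ψ⟩ = u_a + z_a F`, solved for `u`. -/
theorem overlap_system_solution (hJ : IsGaussianStructure J) (hM : IsUnit M.det)
    (hT : IsPosSqrt J (deltaMat J M) T) (z : PhaseVec N) (F : ℂ) (u : Quad N → ℂ)
    (hv : ∀ a, ∑ b, ((1 : PhaseMat N) a b - I * J a b) * (u b + z b * F) = 0)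
    (hu : ∀ a, ∑ b, ((1 : PhaseMat N) a b + I * (T * J * T⁻¹) a b) * u b = 0) :
    I * ∑ a, ((z ᵥ* symOmegaInv N) a : ℂ) * u a =
      (-(1 / 2) * (bil (kahlerInv J * (1 + yMat J M)) z z : ℂ) +
        I / 2 * (bil (symOmegaInv N * yMat J M) z z : ℂ)) * F := by
  set Δ := deltaMat J M
  set W := (1 + Δ)⁻¹ with hW
  set zc : Quad N → ℂ := fun a => (z a : ℂ) with hzc
  have hd := (Matrix.isUnit_iff_isUnit_det _).1 (isUnit_one_add_deltaMat hJ hT)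
  have hv' : (u + F • zc) - I • (complexMat J *ᵥ (u + F • zc)) = 0 := by
    funext a
    have h := hv a
    simp only [sub_mul, Finset.sum_sub_distrib] at h
    simp only [Pi.sub_apply, Pi.smul_apply, Pi.add_apply, smul_eq_mul, Matrix.mulVec, dotProduct,
      complexMat, Matrix.map_apply, Finset.mul_sum, Pi.zero_apply, hzc]
    rw [← h]
    congr 1
    · rw [Finset.sum_eq_single a]
      · simp; ring
      · intro b _ hb; simp [Matrix.one_apply_ne hb.symm]
      · simp
    · exact Finset.sum_congr rfl fun b _ => by ring
  have hu' : u + I • (complexMat (T * J * T⁻¹) *ᵥ u) = 0 := by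
    funext a
    have h := hu a
    simp only [add_mul, Finset.sum_add_distrib] at h
    simp only [Pi.smul_apply, Pi.add_apply, smul_eq_mul, Matrix.mulVec, dotProduct,
      complexMat, Matrix.map_apply, Finset.mul_sum, Pi.zero_apply]
    rw [← h]
    congr 1
    · rw [Finset.sum_eq_single a]
      · simp
      · intro b _ hb; simp [Matrix.one_apply_ne hb.symm]
      · simp
    · exact Finset.sum_congr rfl fun b _ => by ring
  rw [posSqrt_conj_J hJ hM hT] at hu'
  -- Subtracting the two annihilation equations cancels the bare `u`, leaving only `iJu` as unknown.
  have h1 : complexMat (1 + Δ) *ᵥ (I • (complexMat J *ᵥ u)) =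
      F • zc - (I * F) • (complexMat J *ᵥ zc) := by
    have e : complexMat (1 + Δ) *ᵥ (I • (complexMat J *ᵥ u)) =
        I • (complexMat J *ᵥ u) + I • (complexMat (Δ * J) *ᵥ u) := by
      rw [complexMat_add, complexMat_one, Matrix.add_mulVec, Matrix.one_mulVec, complexMat_mul,
        ← Matrix.mulVec_mulVec, Matrix.mulVec_smul]
    rw [Matrix.mulVec_add, Matrix.mulVec_smul] at hv'
    rw [e]
    have := sub_eq_zero.2 (hu'.trans hv'.symm)
    rw [← sub_eq_zero, ← this, mul_smul]
    module
  have h2 : I • (complexMat J *ᵥ u) =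
      F • (complexMat W *ᵥ zc) - (I * F) • (complexMat (W * J) *ᵥ zc) := by
    have h := congrArg (complexMat W *ᵥ ·) h1
    simp only [Matrix.mulVec_mulVec, ← complexMat_mul] at h
    rw [Matrix.nonsing_inv_mul _ hd, complexMat_one, Matrix.one_mulVec, Matrix.mulVec_sub,
      Matrix.mulVec_smul, Matrix.mulVec_smul, Matrix.mulVec_mulVec, ← complexMat_mul] at h
    exact h
  have h3 : u = -(complexMat J *ᵥ (complexMat J *ᵥ u)) := by
    rw [Matrix.mulVec_mulVec, ← complexMat_mul, hJ.sq, complexMat_neg, complexMat_one,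
      Matrix.neg_mulVec, Matrix.one_mulVec, neg_neg]
  have h4 : I * ∑ a, ((z ᵥ* symOmegaInv N) a : ℂ) * u a =
      -((fun a => ((z ᵥ* kahlerInv J) a : ℂ)) ⬝ᵥ (I • (complexMat J *ᵥ u))) := by
    have e : (fun a => ((z ᵥ* kahlerInv J) a : ℂ)) =
        (fun a => ((z ᵥ* symOmegaInv N) a : ℂ)) ᵥ* complexMat J := by
      rw [kahlerInv_eq hJ, ← Matrix.vecMul_vecMul]
      funext a
      simp [Matrix.vecMul, dotProduct, complexMat]
    rw [e, ← Matrix.dotProduct_mulVec, Matrix.mulVec_smul, dotProduct_smul, smul_eq_mul, ← mul_neg,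
      ← dotProduct_neg, ← h3]
    rfl
  have h5 : bil (kahlerInv J * (1 + yMat J M)) z z = 2 * bil (kahlerInv J * W) z z := by
    rw [one_add_yMat hJ hT, mul_smul_comm, bil_smul]
  -- Here `2 g W J = g J + g Y J = -ω + ω J Y J = -ω + ω Y`, and the antisymmetric `ω` vanishes on
  -- the diagonal.
  have h6 : 2 * bil (kahlerInv J * (W * J)) z z = bil (symOmegaInv N * yMat J M) z z := by
    have e : (2 : ℝ) • (kahlerInv J * (W * J)) = -symOmegaInv N + symOmegaInv N * yMat J M := by
      rw [← mul_smul_comm, ← smul_mul_assoc, ← one_add_yMat hJ hT, add_mul, one_mul, mul_add,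
        kahlerInv_mul_J hJ]
      congr 1
      rw [kahlerInv_eq hJ, mul_assoc, ← mul_assoc J, J_mul_yMat_mul_J hJ hM hT]
    rw [← bil_smul, e, bil_add, ← neg_one_smul ℝ (symOmegaInv N), bil_smul, bil_symOmegaInv_self]
    ring
  rw [h4, h2, dotProduct_sub, dotProduct_smul, dotProduct_smul, hzc, complexMat_mulVec_ofReal,
    complexMat_mulVec_ofReal, ofReal_dotProduct, ofReal_dotProduct, ← bil_mul, ← bil_mul, h5, ← h6]
  simp only [smul_eq_mul]
  push_cast
  ring

theorem eq_mul_cexp_of_hasDerivAt {f : ℝ → ℂ} {κ : ℂ}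
    (h : ∀ t : ℝ, HasDerivAt f (t * κ * f t) t) : f 1 = f 0 * cexp (κ / 2) := by
  have h1 : ∀ t : ℝ, HasDerivAt (fun t : ℝ => f t * cexp (-((t : ℂ) ^ 2 * (κ / 2)))) 0 t := by
    intro t
    have ht : HasDerivAt (fun t : ℝ => (t : ℂ)) 1 t := Complex.ofRealCLM.hasDerivAt
    refine ((h t).mul (((ht.pow 2).mul_const (κ / 2)).neg.cexp)).congr_deriv ?_
    simp only [Pi.pow_apply]
    push_cast
    ring
  have h2 := is_const_of_deriv_eq_zero (fun t => (h1 t).differentiableAt) (fun t => (h1 t).deriv) 1 0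
  simp only [ofReal_one, ofReal_zero] at h2
  have h3 : f 1 = f 1 * cexp (-(1 ^ 2 * (κ / 2))) * cexp (κ / 2) := by
    rw [mul_assoc, ← Complex.exp_add]; simp
  rw [h3, h2]; simp

/-- The overlap `⟨φ|D(z)ψ⟩` of two Gaussian states, up to the constant `⟨φ|ψ⟩`. -/
theorem inner_displacement_eq (hJ : IsGaussianStructure J) (hM : IsUnit M.det)
    (hT : IsPosSqrt J (deltaMat J M) T) {φ ψ : Hilb N} {η θ : Quad N → Hilb N}
    (hφ : ∀ a, XiGraph a φ (η a)) (hψ : ∀ a, XiGraph a ψ (θ a))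
    (hη : ∀ a, ∑ b, ((1 : PhaseMat N) a b + I * J a b : ℂ) • η b = 0)
    (hθ : ∀ a, ∑ b, ((1 : PhaseMat N) a b + I * (T * J * T⁻¹) a b : ℂ) • θ b = 0)
    (z : PhaseVec N) :
    inner ℂ φ (displacement z ψ) = inner ℂ φ ψ *
      (cexp (-(1 / 4) * (bil (kahlerInv J * (1 + yMat J M)) z z : ℂ)) *
        cexp (I / 4 * (bil (symOmegaInv N * yMat J M) z z : ℂ))) := by
  set κ : ℂ := -(1 / 2) * (bil (kahlerInv J * (1 + yMat J M)) z z : ℂ) +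
        I / 2 * (bil (symOmegaInv N * yMat J M) z z : ℂ) with hκ
  have key : ∀ t : ℝ, HasDerivAt (fun t : ℝ => inner ℂ φ (displacement (t • z) ψ))
      (t * κ * inner ℂ φ (displacement (t • z) ψ)) t := by
    intro t
    refine (hasDerivAt_inner_displacement (ObsGraph.sum hψ (z ᵥ* symOmegaInv N)) φ t).congr_deriv ?_
    have h1 : inner ℂ φ (displacement (t • z) (I • ∑ a, ((z ᵥ* symOmegaInv N) a : ℂ) • θ a)) =
        I * ∑ a, ((z ᵥ* symOmegaInv N) a : ℂ) * inner ℂ φ (displacement (t • z) (θ a)) := by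
      simp only [map_smul, map_sum, inner_smul_right, inner_sum]
    have hobs : ∀ b, inner ℂ (η b) (displacement (t • z) ψ) =
        inner ℂ φ (displacement (t • z) (θ b)) +
          z b * (t * inner ℂ φ (displacement (t • z) ψ)) := by
      intro b
      rw [(hφ b).inner_eq ((hψ b).displaced (t • z)), map_add, map_smul, inner_add_right,
        inner_smul_right, single_dotProduct]
      simp only [Pi.smul_apply, smul_eq_mul]
      push_cast
      ring
    -- Displacement by `t z` shifts `u_b` by `t z_b F`: this is the system for `z` with `t F` in the
    -- role of `F`.
    rw [h1, overlap_system_solution hJ hM hT z (t * inner ℂ φ (displacement (t • z) ψ))]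
    · ring
    · intro a
      -- The inner product is antilinear in its first slot, so `1 + iJ` becomes `1 - iJ`.
      have h := congrArg (fun x => inner ℂ x (displacement (t • z) ψ)) (hη a)
      simp only [sum_inner, inner_smul_left, inner_zero_left, hobs] at h
      rw [← h]
      refine Finset.sum_congr rfl fun b _ => ?_
      simp only [map_add, map_mul, Complex.conj_ofReal, Complex.conj_I]
      ring
    · intro a
      have h := congrArg (fun x => inner ℂ φ (displacement (t • z) x)) (hθ a)
      simpa only [map_sum, map_smul, inner_sum, inner_smul_right, map_zero, inner_zero_right] using h
  have h := eq_mul_cexp_of_hasDerivAt key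
  simp only [one_smul, zero_smul, displacement_zero] at h
  rw [h, ← Complex.exp_add, hκ]
  congr 2
  ring

end Overlap

/-! ### Plancherel's identity for the Fourier integral on `L¹ ∩ L²`. -/

section Plancherel

variable {E : Type*} [NormedAddCommGroup E] [InnerProductSpace ℝ E] [FiniteDimensional ℝ E]
  [MeasurableSpace E] [BorelSpace E]

open FourierTransform in
/-- The Fourier transform on `L²` agrees with the Fourier integral on `L¹ ∩ L²`. -/
theorem fourier_toLp_ae_eq {h : E → ℂ} (h1 : Integrable h) (h2 : MemLp h 2) :
    (𝓕 (h2.toLp h) : Lp ℂ 2 (volume : Measure E)) =ᵐ[volume] 𝓕 h := by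
  have hc : Continuous (𝓕 h) := VectorFourier.fourierIntegral_continuous Real.continuous_fourierChar
    (innerSL ℝ).continuous₂ h1
  refine ae_eq_of_integral_contDiff_smul_eq
    ((Lp.memLp _).locallyIntegrable (by norm_num)) hc.locallyIntegrable fun g hg hgc => ?_
  have hg₁ : HasCompactSupport (Complex.ofRealCLM ∘ g) := hgc.comp_left rfl
  have hg₂ : ContDiff ℝ (⊤ : ℕ∞) (Complex.ofRealCLM ∘ g) := by fun_prop
  set G : 𝓢(E, ℂ) := hg₁.toSchwartzMap hg₂ with hG
  have hGg : ∀ x, G x = (g x : ℂ) := fun x => rfl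
  -- Both transforms define the same tempered distribution: the `L²` one by duality, the integral by
  -- Fubini's exchange of the transform between `G` and `h`.
  have e1 := congrArg (fun D => D G) (Lp.fourier_toTemperedDistribution_eq (h2.toLp h))
  simp only [TemperedDistribution.fourier_apply, Lp.toTemperedDistribution_apply] at e1
  have e2 : ∫ x, (𝓕 G) x • (h2.toLp h) x = ∫ x, (𝓕 G) x • h x := by
    refine integral_congr_ae ?_
    filter_upwards [h2.coeFn_toLp] with x hx
    rw [hx]
  have e3 : ∫ x, (𝓕 G) x • h x = ∫ x, G x • 𝓕 h x := by
    have := VectorFourier.integral_fourierIntegral_smul_eq_flip (L := innerₗ E)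
      (μ := volume) (ν := volume) Real.continuous_fourierChar (innerSL ℝ).continuous₂
      G.integrable h1
    rw [flip_innerₗ] at this
    rw [SchwartzMap.fourier_coe]
    exact this
  rw [e2, e3] at e1
  simpa [hGg] using e1.symm

open FourierTransform in
theorem lintegral_enorm_fourier_sq {h : E → ℂ} (h1 : Integrable h) (h2 : MemLp h 2) :
    ∫⁻ w, ‖𝓕 h w‖ₑ ^ 2 = ∫⁻ x, ‖h x‖ₑ ^ 2 := by
  have e0 : ∀ f : E → ℂ, ∫⁻ x, ‖f x‖ₑ ^ 2 = eLpNorm f 2 volume ^ 2 := by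
    intro f
    have := eLpNorm_nnreal_pow_eq_lintegral (f := f) (μ := (volume : Measure E)) (p := 2) (by norm_num)
    simpa using this.symm
  rw [e0, e0, ← eLpNorm_congr_ae (fourier_toLp_ae_eq h1 h2), ← eLpNorm_congr_ae h2.coeFn_toLp,
    ← Lp.enorm_def, ← Lp.enorm_def, ← ofReal_norm, ← ofReal_norm, Lp.norm_fourier_eq]

end Plancherel

/-! ### The Gaussian integral of a positive definite form. -/

section GaussianIntegral

theorem lintegral_exp_neg_half_dotProduct {n : Type*} [Fintype n] [DecidableEq n] :
    ∫⁻ y : n → ℝ, ENNReal.ofReal (Real.exp (-(1 / 2) * (y ⬝ᵥ y))) =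
      ENNReal.ofReal ((2 * Real.pi) ^ (Fintype.card n / 2 : ℝ)) := by
  have h1 := GaussianFourier.integral_rexp_neg_mul_sq_norm (V := EuclideanSpace ℝ n)
    (b := 1 / 2) (by norm_num)
  have e : Real.pi / (1 / 2) = 2 * Real.pi := by ring
  rw [e, finrank_euclideanSpace] at h1
  have hi : Integrable (fun v : EuclideanSpace ℝ n => Real.exp (-(1 / 2) * ‖v‖ ^ 2)) := by
    -- A non-integrable function would have Bochner integral `0` by default, while the known value
    -- is positive.
    by_contra hn
    rw [integral_undef hn] at h1
    have : 0 < (2 * Real.pi) ^ (Fintype.card n / 2 : ℝ) := by positivity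
    linarith
  rw [← h1, ofReal_integral_eq_lintegral_ofReal hi (Filter.Eventually.of_forall fun _ => by positivity),
    ← (PiLp.volume_preserving_ofLp n).lintegral_comp (by fun_prop)]
  refine lintegral_congr fun v => ?_
  rw [EuclideanSpace.real_norm_sq_eq]
  simp [dotProduct, sq]

theorem lintegral_exp_neg_half_quadratic {n : Type*} [Fintype n] [DecidableEq n] {A : Matrix n n ℝ}
    (hA : A.PosDef) :
    ∫⁻ z : n → ℝ, ENNReal.ofReal (Real.exp (-(1 / 2) * (z ⬝ᵥ A *ᵥ z))) =
      ENNReal.ofReal ((2 * Real.pi) ^ (Fintype.card n / 2 : ℝ) / √A.det) := by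
  obtain ⟨B, hB⟩ := exists_conjTranspose_mul_self_of_posSemidef hA.posSemidef
  have hdet : A.det = B.det ^ 2 := by rw [hB, Matrix.det_mul, Matrix.det_conjTranspose]; simp [sq]
  have hB0 : B.det ≠ 0 := by
    intro h0
    have := hA.det_pos
    rw [hdet, h0] at this
    norm_num at this
  have hq : ∀ z : n → ℝ, z ⬝ᵥ A *ᵥ z = (B *ᵥ z) ⬝ᵥ (B *ᵥ z) := by
    intro z
    rw [hB, Matrix.conjTranspose_eq_transpose_of_trivial, ← Matrix.mulVec_mulVec,
      Matrix.dotProduct_mulVec, Matrix.vecMul_transpose]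
  have hm : Measurable (fun y : n → ℝ => ENNReal.ofReal (Real.exp (-(1 / 2) * (y ⬝ᵥ y)))) := by
    unfold dotProduct
    fun_prop
  have h1 := lintegral_map (μ := (volume : Measure (n → ℝ))) hm
    (Matrix.toLin' B).continuous_of_finiteDimensional.measurable
  rw [Real.map_matrix_volume_pi_eq_smul_volume_pi hB0, lintegral_smul_measure,
    lintegral_exp_neg_half_dotProduct, smul_eq_mul, ← ENNReal.ofReal_mul (by positivity)] at h1
  simp only [hq]
  simp only [Matrix.toLin'_apply] at h1
  rw [← h1, hdet, Real.sqrt_sq_eq_abs, abs_inv, mul_comm, div_eq_mul_inv _ |B.det|]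

end GaussianIntegral

/-! ### Orthogonality relation of the displacement operators. -/

section Moyal

variable {N : ℕ}

theorem lintegral_phaseVec (f : PhaseVec N → ENNReal) (hf : Measurable f) :
    ∫⁻ q : Config N, ∫⁻ p : Config N, f (Sum.elim q.ofLp p.ofLp) = ∫⁻ z, f z := by
  have h1 := (volume_measurePreserving_sumPiEquivProdPi_symm
    (fun _ : Fin N ⊕ Fin N => ℝ)).lintegral_comp hf
  have hm : Measurable (fun a : (Fin N → ℝ) × (Fin N → ℝ) =>
      f ((MeasurableEquiv.sumPiEquivProdPi fun _ : Fin N ⊕ Fin N => ℝ).symm a)) :=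
    hf.comp (MeasurableEquiv.measurable _)
  rw [← h1, Measure.volume_eq_prod, lintegral_prod _ hm.aemeasurable,
    ← (PiLp.volume_preserving_ofLp (Fin N)).lintegral_comp hm.lintegral_prod_right']
  refine lintegral_congr fun q => ?_
  rw [← (PiLp.volume_preserving_ofLp (Fin N)).lintegral_comp
    (f := fun p => f ((MeasurableEquiv.sumPiEquivProdPi fun _ : Fin N ⊕ Fin N => ℝ).symm (q.ofLp, p)))
    (hm.comp measurable_prodMk_left)]
  refine lintegral_congr fun p => ?_
  congr 1

theorem lintegral_comp_neg_two_pi_inv_smul (f : Config N → ENNReal) (hf : Measurable f) :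
    ∫⁻ p : Config N, f ((-(2 * Real.pi)⁻¹ : ℝ) • p) =
      ENNReal.ofReal ((2 * Real.pi) ^ N) * ∫⁻ w, f w := by
  have h0 : (-(2 * Real.pi)⁻¹ : ℝ) ≠ 0 := by
    have := Real.pi_pos
    simp [this.ne']
  have h1 := lintegral_map (μ := (volume : Measure (Config N))) hf
    (measurable_const_smul (-(2 * Real.pi)⁻¹ : ℝ))
  rw [← h1, Measure.map_addHaar_smul _ h0, lintegral_smul_measure, smul_eq_mul,
    finrank_euclideanSpace_fin]
  congr 2
  rw [abs_inv, abs_pow, abs_neg, abs_inv, abs_of_pos (by positivity : 0 < 2 * Real.pi), inv_pow,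
    inv_inv]

open FourierTransform in
-- For fixed `q` the overlap is, up to a unimodular factor, a Fourier transform in `p`. The kernel
-- `exp(-2πi x·w)` explains the argument `w = -p/(2π)`, whose Jacobian produces the constant
-- `(2π)^N`.
theorem enorm_inner_displacement (φ ψ : Hilb N) (q p : Config N) :
    ‖(inner ℂ φ (displacement (Sum.elim q.ofLp p.ofLp) ψ) : ℂ)‖ₑ =
      ‖𝓕 (fun x => (inner ℂ (φ x) (translation q ψ x) : ℂ)) ((-(2 * Real.pi)⁻¹ : ℝ) • p)‖ₑ := by
  set z : PhaseVec N := Sum.elim q.ofLp p.ofLp with hz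
  set c : ℂ := cexp (-(I / 2 * ((∑ j, z (Sum.inl j) * z (Sum.inr j) : ℝ) : ℂ))) with hc
  have hcn : ‖c‖ₑ = 1 := by
    have : ‖c‖ = 1 := by
      rw [hc, Complex.norm_exp]
      simp only [Complex.neg_re, Complex.mul_re, Complex.ofReal_re, Complex.ofReal_im,
        Complex.I_re, Complex.I_im, Complex.div_ofNat_re, Complex.div_ofNat_im]
      simp
    rw [← ofReal_norm, this, ENNReal.ofReal_one]
  have key : (inner ℂ φ (displacement z ψ) : ℂ) =
      c * 𝓕 (fun x => (inner ℂ (φ x) (translation q ψ x) : ℂ)) ((-(2 * Real.pi)⁻¹ : ℝ) • p) := by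
    rw [L2.inner_def, Real.fourier_eq, ← integral_const_mul]
    refine integral_congr_ae ?_
    have h2 : displacement z ψ =ᵐ[volume] fun x => weylFactor z x * translation q ψ x :=
      MemLp.coeFn_toLp (memLp_weylFactor_mul z (translation (qPart z) ψ))
    filter_upwards [h2] with x hx
    rw [hx, Circle.smul_def, Real.fourierChar_apply, weylFactor, sub_eq_add_neg, Complex.exp_add]
    have e : (I * ((∑ j, z (Sum.inr j) * x j : ℝ) : ℂ)) =
        ((2 * Real.pi * -inner ℝ x ((-(2 * Real.pi)⁻¹ : ℝ) • p) : ℝ) : ℂ) * I := by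
      rw [inner_smul_right, mul_comm]
      congr 2
      have hp := Real.pi_pos
      rw [PiLp.inner_apply]
      field_simp
      simp [hz]
    rw [e]
    simp only [RCLike.inner_apply, smul_eq_mul]
    ring
  rw [key, enorm_mul, hcn, one_mul]

theorem lintegral_enorm_inner_translation (φ ψ : Hilb N) (q : Config N) :
    ∫⁻ x, ‖(inner ℂ (φ x) (translation q ψ x) : ℂ)‖ₑ ^ 2 =
    ∫⁻ x, ‖φ x‖ₑ ^ 2 * ‖ψ (x - q)‖ₑ ^ 2 := by
  refine lintegral_congr_ae ?_
  filter_upwards [Lp.coeFn_compMeasurePreserving ψ (measurePreserving_sub_right volume q)]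
    with x hx
  have hx' : translation q ψ x = ψ (x - q) := hx
  rw [hx', RCLike.inner_apply, enorm_mul, mul_pow, mul_comm]
  congr 2
  simp [← ofReal_norm]

theorem lintegral_lintegral_enorm_translation (φ ψ : Hilb N) :
    ∫⁻ q : Config N, ∫⁻ x, ‖(inner ℂ (φ x) (translation q ψ x) : ℂ)‖ₑ ^ 2 = ‖φ‖ₑ ^ 2 * ‖ψ‖ₑ ^ 2 := by
  have e0 : ∀ f : Hilb N, ∫⁻ x, ‖f x‖ₑ ^ 2 = ‖f‖ₑ ^ 2 := by
    intro f
    have := eLpNorm_nnreal_pow_eq_lintegral (f := f) (μ := (volume : Measure (Config N))) (p := 2)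
      (by norm_num)
    rw [Lp.enorm_def]
    simpa using this.symm
  have hφ : Measurable φ := (Lp.stronglyMeasurable φ).measurable
  have hψ : Measurable ψ := (Lp.stronglyMeasurable ψ).measurable
  simp only [lintegral_enorm_inner_translation]
  rw [lintegral_lintegral_swap (by fun_prop)]
  have h2 : ∀ x, ∫⁻ q, ‖φ x‖ₑ ^ 2 * ‖ψ (x - q)‖ₑ ^ 2 = ‖φ x‖ₑ ^ 2 * ‖ψ‖ₑ ^ 2 := by
    intro x
    rw [lintegral_const_mul _ (by fun_prop), ← e0 ψ,
      lintegral_sub_left_eq_self (fun y => ‖ψ y‖ₑ ^ 2) x]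
  simp only [h2]
  rw [lintegral_mul_const _ (by fun_prop), e0]

/-- The orthogonality relation of the displacement operators. -/
theorem lintegral_enorm_inner_displacement_sq (φ ψ : Hilb N) :
    ∫⁻ q : Config N, ∫⁻ p : Config N,
        ‖(inner ℂ φ (displacement (Sum.elim q.ofLp p.ofLp) ψ) : ℂ)‖ₑ ^ 2 =
      ENNReal.ofReal ((2 * Real.pi) ^ N) * (‖φ‖ₑ ^ 2 * ‖ψ‖ₑ ^ 2) := by
  have hφ : Measurable φ := (Lp.stronglyMeasurable φ).measurable
  have hψ : Measurable ψ := (Lp.stronglyMeasurable ψ).measurable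
  have hm : Measurable fun q : Config N =>
      ∫⁻ x, ‖(inner ℂ (φ x) (translation q ψ x) : ℂ)‖ₑ ^ 2 := by
    simp only [lintegral_enorm_inner_translation]
    exact Measurable.lintegral_prod_right'
      (f := fun a : Config N × Config N => ‖φ a.2‖ₑ ^ 2 * ‖ψ (a.2 - a.1)‖ₑ ^ 2) (by fun_prop)
  have hfin : ∫⁻ q : Config N, ∫⁻ x, ‖(inner ℂ (φ x) (translation q ψ x) : ℂ)‖ₑ ^ 2 ≠ ⊤ := by
    rw [lintegral_lintegral_enorm_translation]
    finiteness
  rw [← lintegral_lintegral_enorm_translation, ← lintegral_const_mul' _ _ ENNReal.ofReal_ne_top]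
  refine lintegral_congr_ae ?_
  -- A product of two `L²` functions need only be `L¹`; finiteness of the double integral makes it
  -- `L²` for almost every `q`, which suffices for Plancherel.
  filter_upwards [ae_lt_top hm hfin] with q hq
  have h1 : Integrable fun x => (inner ℂ (φ x) (translation q ψ x) : ℂ) :=
    L2.integrable_inner φ (translation q ψ)
  have h2 : MemLp (fun x => (inner ℂ (φ x) (translation q ψ x) : ℂ)) 2 := by
    refine ⟨h1.aestronglyMeasurable, ?_⟩
    have e := eLpNorm_nnreal_pow_eq_lintegral
      (f := fun x => (inner ℂ (φ x) (translation q ψ x) : ℂ))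
      (μ := (volume : Measure (Config N))) (p := 2) (by norm_num)
    have e' : eLpNorm (fun x => (inner ℂ (φ x) (translation q ψ x) : ℂ)) 2 volume ^ 2 < ⊤ := by
      refine lt_of_eq_of_lt ?_ hq
      simpa using e
    exact (ENNReal.pow_lt_top_iff.1 e').resolve_right (by norm_num)
  have hc := VectorFourier.fourierIntegral_continuous Real.continuous_fourierChar
    (innerSL ℝ).continuous₂ h1
  simp only [enorm_inner_displacement]
  rw [lintegral_comp_neg_two_pi_inv_smul (fun w => ‖FourierTransform.fourier
    (fun x => (inner ℂ (φ x) (translation q ψ x) : ℂ)) w‖ₑ ^ 2) (by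
      have : Measurable (FourierTransform.fourier
        (fun x => (inner ℂ (φ x) (translation q ψ x) : ℂ))) := Continuous.measurable hc
      fun_prop),
    lintegral_enorm_fourier_sq h1 h2]

/-- A displaced overlap of normalized states which is a centred Gaussian determines its value at
the origin. -/
theorem norm_inner_eq_of_gaussian_overlap {φ ψ : Hilb N} (hφ : ‖φ‖ = 1) (hψ : ‖ψ‖ = 1)
    {A : PhaseMat N} (hA : A.PosDef)
    (h : ∀ z : PhaseVec N, ‖(inner ℂ φ (displacement z ψ) : ℂ)‖ =
      ‖(inner ℂ φ ψ : ℂ)‖ * Real.exp (-(1 / 4) * (z ⬝ᵥ A *ᵥ z))) :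
    ‖(inner ℂ φ ψ : ℂ)‖ ^ 2 = √A.det := by
  set c := ‖(inner ℂ φ ψ : ℂ)‖ with hc
  have h1 : ∀ z : PhaseVec N, ‖(inner ℂ φ (displacement z ψ) : ℂ)‖ₑ ^ 2 =
      ENNReal.ofReal (c ^ 2) * ENNReal.ofReal (Real.exp (-(1 / 2) * (z ⬝ᵥ A *ᵥ z))) := by
    intro z
    rw [← ofReal_norm, h, ← ENNReal.ofReal_pow (by positivity), ← ENNReal.ofReal_mul (by positivity),
      mul_pow, ← Real.exp_nat_mul]
    congr 3
    push_cast
    ring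
  have h2 := lintegral_enorm_inner_displacement_sq φ ψ
  simp only [h1] at h2
  rw [lintegral_phaseVec (fun z : PhaseVec N => ENNReal.ofReal (c ^ 2) *
      ENNReal.ofReal (Real.exp (-(1 / 2) * (z ⬝ᵥ A *ᵥ z)))) (by
        simp only [dotProduct, Matrix.mulVec]
        fun_prop),
    lintegral_const_mul' _ _ ENNReal.ofReal_ne_top, lintegral_exp_neg_half_quadratic hA,
    ← ENNReal.ofReal_mul (by positivity), ← ofReal_norm, ← ofReal_norm, hφ, hψ] at h2
  simp only [ENNReal.ofReal_one, one_pow, mul_one] at h2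
  rw [ENNReal.ofReal_eq_ofReal_iff (by positivity) (by positivity)] at h2
  have h3 : ((Fintype.card (Quad N) : ℝ) / 2) = (N : ℝ) := by
    simp [Fintype.card_sum]
  have h4 : 0 < √A.det := Real.sqrt_pos.2 hA.det_pos
  have h5 : (0 : ℝ) < (2 * Real.pi) ^ N := by positivity
  rw [h3, Real.rpow_natCast] at h2
  field_simp at h2
  exact h2

end Moyal

/-! ### Canonical commutation relations on Schwartz functions. -/

section Commutator

variable {N : ℕ}

theorem bil_symOmegaInv (z y : PhaseVec N) : bil (symOmegaInv N) z y =
    ∑ j, z (Sum.inr j) * y (Sum.inl j) - ∑ j, z (Sum.inl j) * y (Sum.inr j) := by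
  simp only [bil, dotProduct, Matrix.mulVec, symOmegaInv, Fintype.sum_sum_type,
    Matrix.fromBlocks_apply₁₁, Matrix.fromBlocks_apply₁₂, Matrix.fromBlocks_apply₂₁,
    Matrix.fromBlocks_apply₂₂, Matrix.neg_apply, Matrix.one_apply, Matrix.zero_apply]
  simp
  ring

/-- The canonical commutation relations `[ŷ, ẑ] = -i ω(z, y)` on Schwartz functions. -/
theorem hatS_commutator (y z : PhaseVec N) (f : 𝓢(Config N, ℂ)) :
    hatS y (hatS z f) - hatS z (hatS y f) = (-I * (bil (symOmegaInv N) z y : ℂ)) • f := by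
  have hd : ∀ (a b : PhaseVec N) (x : Config N), fderiv ℝ (hatS a f) x (qPart b) =
      I * ((∑ j, a (Sum.inr j) * b (Sum.inl j) : ℝ) : ℂ) * f x +
        I * ((∑ j, a (Sum.inr j) * x j : ℝ) : ℂ) * fderiv ℝ f x (qPart b) -
        fderiv ℝ (fderiv ℝ f) x (qPart b) (qPart a) := by
    intro a b x
    have he : (hatS a f : Config N → ℂ) = fun x =>
        I * ((∑ j, a (Sum.inr j) * x j : ℝ) : ℂ) * f x - fderiv ℝ f x (qPart a) :=
      funext (hatS_apply a f)
    have h1 : HasFDerivAt (fun x : Config N => ((∑ j, a (Sum.inr j) * x j : ℝ) : ℂ))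
        (Complex.ofRealCLM ∘L ∑ j, a (Sum.inr j) • (EuclideanSpace.proj j : Config N →L[ℝ] ℝ)) x := by
      convert (Complex.ofRealCLM ∘L
        ∑ j, a (Sum.inr j) • (EuclideanSpace.proj j : Config N →L[ℝ] ℝ)).hasFDerivAt using 1
      funext x
      simp [_root_.sum_apply]
    have h2 : HasFDerivAt (fderiv ℝ f) (fderiv ℝ (fderiv ℝ f) x) x :=
      (((f.smooth 2).fderiv_right (m := 1) (by norm_num)).differentiable (by norm_num) x).hasFDerivAt
    have h3 := ((h1.const_mul I).mul (f.hasFDerivAt x)).sub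
      (h2.clm_apply (hasFDerivAt_const (qPart a) x))
    rw [he]
    refine (DFunLike.congr_fun h3.fderiv (qPart b)).trans ?_
    simp [_root_.sum_apply, qPart]
    ring
  have hsymm : ∀ x, fderiv ℝ (fderiv ℝ f) x (qPart y) (qPart z) =
      fderiv ℝ (fderiv ℝ f) x (qPart z) (qPart y) := by
    intro x
    exact ((f.smooth 2).contDiffAt.isSymmSndFDerivAt (by simp)).eq _ _
  ext x
  rw [_root_.sub_apply, _root_.smul_apply, hatS_apply, hatS_apply, hatS_apply, hatS_apply, hd, hd,
    hsymm, bil_symOmegaInv]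
  have e : ∑ j, y (Sum.inr j) * z (Sum.inl j) = ∑ j, z (Sum.inl j) * y (Sum.inr j) :=
    Finset.sum_congr rfl fun j _ => mul_comm _ _
  rw [e, smul_eq_mul]
  push_cast
  ring

end Commutator

/-! ### The squeezed state and the constant at the origin. -/

section Squeezing

variable {N : ℕ} {J M T : PhaseMat N}

/-- This follows from the intertwining `(1 + i T J T⁻¹) T = T (1 + iJ)`. It makes the squeezed
vector a Gaussian state for `T J T⁻¹`. -/
theorem sum_smul_squeezed_eq_zero {H : Type*} [AddCommGroup H] [Module ℂ H] {η : Quad N → H}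
    (hT : IsUnit T.det)
    (hη : ∀ a, ∑ b, ((1 : PhaseMat N) a b + I * J a b : ℂ) • η b = 0) (a : Quad N) :
    ∑ b, ((1 : PhaseMat N) a b + I * (T * J * T⁻¹) a b : ℂ) • ∑ c, (T b c : ℂ) • η c = 0 := by
  have hm : (complexMat 1 + I • complexMat (T * J * T⁻¹)) * complexMat T =
      complexMat T * (complexMat 1 + I • complexMat J) := by
    rw [add_mul, mul_add, smul_mul_assoc, mul_smul_comm, ← complexMat_mul, ← complexMat_mul,
      ← complexMat_mul, ← complexMat_mul, mul_assoc, Matrix.nonsing_inv_mul _ hT, mul_one, one_mul,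
      mul_one]
  have hc : ∀ c, ∑ b, ((1 : PhaseMat N) a b + I * (T * J * T⁻¹) a b : ℂ) * (T b c : ℂ) =
      ∑ b, (T a b : ℂ) * ((1 : PhaseMat N) b c + I * J b c : ℂ) :=
    fun c => congrFun (congrFun hm a) c
  simp only [Finset.smul_sum, smul_smul]
  rw [Finset.sum_comm]
  simp only [← Finset.sum_smul, hc]
  simp only [Finset.sum_smul, mul_smul]
  rw [Finset.sum_comm]
  simp only [← Finset.smul_sum, hη, smul_zero, Finset.sum_const_zero]

theorem IsGaussianState.sum_smul_eq_zero {η : Quad N → Hilb N}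
    (h : ∀ a, ∑ b, ((1 / 2 : ℂ) * ((1 : PhaseMat N) a b + I * J a b)) • η b = 0) (a : Quad N) :
    ∑ b, ((1 : PhaseMat N) a b + I * J a b : ℂ) • η b = 0 := by
  have h1 := h a
  simp only [mul_smul, ← Finset.smul_sum] at h1
  exact (smul_eq_zero.1 h1).resolve_left (by norm_num)

/-- The overlap of a Gaussian state with its displaced and squeezed image, up to its value at the
origin. -/
theorem expVal_displacement_squeezing (hJ : IsGaussianStructure J) (hM : IsUnit M.det)
    (hT : IsPosSqrt J (deltaMat J M) T) {φ : Hilb N} (hφ : IsGaussianState J φ)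
    {S : Hilb N ≃ₗᵢ[ℂ] Hilb N} {c : ℂ} (hS : IsSqueezing φ T c S) (z : PhaseVec N) :
    expVal φ (fun u => displacement z (S u)) = expVal φ S *
      (cexp (-(1 / 4) * (bil (kahlerInv J * (1 + yMat J M)) z z : ℂ)) *
        cexp (I / 4 * (bil (symOmegaInv N * yMat J M) z z : ℂ))) := by
  obtain ⟨-, η, hη, hann⟩ := hφ
  have hann' := IsGaussianState.sum_smul_eq_zero hann
  refine inner_displacement_eq hJ hM hT hη (θ := fun a => S (∑ b, (T a b : ℂ) • η b))
    -- Covariance places `S φ` in the domain of `ξ^a`, with image `S (∑ T^a_b ξ^b φ)`.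
    (fun a => (hS.covariance a _ _).2 (ObsGraph.sum hη (T a))) hann' (fun a => ?_) z
  have h := congrArg S (sum_smul_squeezed_eq_zero (isUnit_det_posSqrt hT) hann' a)
  simpa only [map_sum, map_smul, map_zero] using h

theorem norm_cexp_gaussian_mul_phase (a b : ℝ) :
    ‖cexp (-(1 / 4) * (a : ℂ)) * cexp (I / 4 * (b : ℂ))‖ = Real.exp (-(1 / 4) * a) := by
  rw [norm_mul, Complex.norm_exp, Complex.norm_exp]
  simp

theorem expVal_squeezing (hJ : IsGaussianStructure J) (hM : IsUnit M.det)
    (hT : IsPosSqrt J (deltaMat J M) T) {φ : Hilb N} (hφ : IsGaussianState J φ)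
    {S : Hilb N ≃ₗᵢ[ℂ] Hilb N} (hS : IsSqueezing φ T 1 S) :
    expVal φ S = (((1 - yMat J M ^ 2).det ^ (1 / 8 : ℝ) : ℝ) : ℂ) := by
  have hd := det_one_add_yMat_pos hJ hT
  have h1 := norm_inner_eq_of_gaussian_overlap (φ := φ) (ψ := S φ) hφ.1
    ((S.norm_map φ).trans hφ.1) (posDef_kahlerInv_mul_one_add_yMat hJ hT) (fun z => by
      have := congrArg norm (expVal_displacement_squeezing hJ hM hT hφ hS z)
      rw [norm_mul, norm_cexp_gaussian_mul_phase] at this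
      exact this)
  rw [Matrix.det_mul, det_kahlerInv hJ, one_mul] at h1
  have h2 : ‖expVal φ S‖ = (1 - yMat J M ^ 2).det ^ (1 / 8 : ℝ) := by
    rw [det_one_sub_yMat_sq hJ hM hT, ← Real.rpow_natCast, ← Real.rpow_mul hd.le]
    have h3 : ‖expVal φ S‖ = √√(1 + yMat J M).det := by
      rw [← h1, Real.sqrt_sq (norm_nonneg _)]
      rfl
    rw [h3, Real.sqrt_eq_rpow, Real.sqrt_eq_rpow, ← Real.rpow_mul hd.le]
    norm_num
  have h4 := hS.phase
  rw [refPhase, map_one] at h4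
  -- A vanishing expectation value would give the phase `0 / 0 = 0`, so the normalization to phase
  -- `1` already excludes it.
  have h5 : (‖expVal φ S‖ : ℂ) ≠ 0 := by
    intro h0
    rw [h0, div_zero] at h4
    exact zero_ne_one h4
  rw [div_eq_one_iff_eq h5] at h4
  rw [h4, h2]

end Squeezing

end

theorem lemma1 (N : ℕ) (J M T : PhaseMat N)
    (hJ : IsGaussianStructure J)
    (hM : M ∈ Matrix.symplecticGroup (Fin N) ℝ)
    (hT : IsPosSqrt J (deltaMat J M) T)
    (φ : Hilb N) (hφ : IsGaussianState J φ)
    (S : Hilb N ≃ₗᵢ[ℂ] Hilb N) (hS : IsSqueezing φ T 1 S)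
    (z : PhaseVec N) :
    -- the matrices `Δ_M` and `Y_M`
    deltaMat J M = M * metricTranspose J M ∧
    IsUnit (1 + deltaMat J M) ∧
    yMat J M = (2 : ℝ) • (1 + deltaMat J M)⁻¹ - 1 ∧
    IsUnit (linPart J M⁻¹) ∧
    yMat J M = zMat J M⁻¹ ∧
    -- the expectation value
    0 < (1 - yMat J M ^ 2).det ∧
    expVal φ (fun u => displacement z (S u)) =
      (((1 - yMat J M ^ 2).det ^ (1 / 8 : ℝ) : ℝ) : ℂ) *
        cexp (-(1 / 4) * (bil (kahlerInv J * (1 + yMat J M)) z z : ℂ)) *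
        cexp (I / 4 * (bil (symOmegaInv N * yMat J M) z z : ℂ)) ∧
    -- its phase
    refPhase φ (fun u => displacement z (S u)) = cexp (I * (gammaPhase J M z : ℂ)) ∧
    (∀ f : SchwartzMap (Config N) ℂ,
      (I / 4) • (hatS (yMat J M *ᵥ z) (hatS z f) - hatS z (hatS (yMat J M *ᵥ z) f)) =
        (gammaPhase J M z : ℂ) • f) ∧
    gammaPhase J M z = (1 / 4) * bil (symOmegaInv N * yMat J M) z z ∧
    -- its modulus
    expVal φ S = (((1 - yMat J M ^ 2).det ^ (1 / 8 : ℝ) : ℝ) : ℂ) ∧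
    ‖expVal φ (fun u => displacement z (S u))‖ =
      ‖expVal φ S‖ *
        Real.exp (-(1 / 2) * bil (kahlerInv J * (1 + M * metricTranspose J M)⁻¹) z z) := by
  have hMd : IsUnit M.det := SymplecticGroup.symplectic_det hM
  have hΔ := deltaMat_eq_mul_metricTranspose hJ hM
  have hu := isUnit_one_add_deltaMat hJ hT
  have hpos := det_one_add_yMat_pos hJ hT
  have hdet : 0 < (1 - yMat J M ^ 2).det := by
    rw [det_one_sub_yMat_sq hJ hMd hT]
    positivity
  have hS0 := expVal_squeezing hJ hMd hT hφ hS
  have hSz := expVal_displacement_squeezing hJ hMd hT hφ hS z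
  have hγ : gammaPhase J M z = (1 / 4) * bil (symOmegaInv N * yMat J M) z z := by
    rw [gammaPhase, bil, bil, Matrix.mulVec_mulVec]
  have hc : 0 < (1 - yMat J M ^ 2).det ^ (1 / 8 : ℝ) := Real.rpow_pos_of_pos hdet _
  have hnorm : ‖expVal φ (fun u => displacement z (S u))‖ = ‖expVal φ S‖ *
      Real.exp (-(1 / 4) * bil (kahlerInv J * (1 + yMat J M)) z z) := by
    rw [hSz, norm_mul, norm_cexp_gaussian_mul_phase]
  refine ⟨hΔ, hu, yMat_eq hJ hT, isUnit_linPart_inv hMd hu, yMat_eq_zMat_inv hMd hu, hdet, ?_, ?_,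
    ?_, hγ, hS0, ?_⟩
  · rw [hSz, hS0, mul_assoc]
  · have hr : ((1 - yMat J M ^ 2).det ^ (1 / 8 : ℝ) *
        Real.exp (-(1 / 4) * bil (kahlerInv J * (1 + yMat J M)) z z) : ℝ) ≠ 0 :=
      (mul_pos hc (Real.exp_pos _)).ne'
    rw [refPhase, hnorm, hSz, hS0, Complex.norm_of_nonneg hc.le,
      div_eq_iff (Complex.ofReal_ne_zero.2 hr), hγ]
    push_cast
    ring_nf
  · intro f
    rw [hatS_commutator, smul_smul, gammaPhase]
    congr 1
    push_cast
    linear_combination (-(1 / 4) * (bil (symOmegaInv N) z (yMat J M *ᵥ z) : ℂ)) * I_mul_I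
  -- The exponent `-1/4` becomes `-1/2` because `1 + Y = 2 (1 + Δ)⁻¹`.
  · rw [hnorm, one_add_yMat hJ hT, mul_smul_comm, bil_smul, hΔ]
    congr 2
    ring
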